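/- Let $G=(V,E)$ be a finite connected multi-graph (self-loops and multiple edges allowed), let $\vec E$ be its set of directed edges (each edge with both orientations, so a self-loop gives two directed edges), and write $o(e)$, $t(e)$ and $e^{-1}$ for the origin, the terminus and the reversal of $e\in\vec E$. Let $\mathcal H$ be a Schrödinger operator on $G$, given by weights $w_e\in\mathbb C\setminus\{0\}$ with $w_{e^{-1}}=\overline{w_e}$ for $e\in\vec E$ and a potential $\mathcal V:V\to\mathbb R$: $$(\mathcal Hf)(u)=\sum_{e\in\vec E,\ o(e)=u}w_e\,f(t(e))+\mathcal V_u f(u).$$ Let $G^{\mathrm{ab}}=\tilde G/[\pi_1(G),\pi_1(G)]$ be the maximal abelian cover of $G$, where $\tilde G$ is the universal cover of $G$, and let $\mathcal H^{\mathrm{ab}}$ be the Schrödinger operator on $\ell^2(G^{\mathrm{ab}})$ obtained by pulling back the weights and the potential. A degree-$k$ subgraph of $G$ is a subgraph in which every vertex has degree exactly $k$ (a self-loop counts twice towards the degree); the empty subgraph is included. A matching is a degree-$1$ subgraph. For a degree-$2$ subgraph $\gamma$, let $G\setminus\gamma$ be the induced subgraph of $G$ on $V\setminus V_\gamma$, let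 $\mathcal H|_{G\setminus\gamma}$ be the Schrödinger operator on it given by the restricted weights and potential, and let $$m^{\mathcal H}_{G\setminus\gamma}(x)=\sum_{M}(-1)^{|V_M|/2}\prod_{e\in\vec E_M}w_e\prod_{u\in V\setminus (V_\gamma\cup V_M)}(x-\mathcal V_u),$$ the sum being over all matchings $M$ of $G\setminus\gamma$, with vertex set $V_M$ and set of directed edges $\vec E_M$. Then for every $\lambda\in\mathbb R$ the following are equivalent: 1. $\lambda$ is an eigenvalue of $\mathcal H^{\mathrm{ab}}$, i.e. $\mathcal H^{\mathrm{ab}}f=\lambda f$ for some non-zero $f\in\ell^2(G^{\mathrm{ab}})$; 2. for every degree-$2$ subgraph $\gamma$ of $G$ (the empty one included), $\lambda$ is a root of $m^{\mathcal H}_{G\setminus\gamma}$; 3. for every degree-$2$ subgraph $\gamma$ of $G$ (the empty one included), $\lambda$ is an eigenvalue of $\mathcal H|_{G\setminus\gamma}$. -/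

import Mathlib

open CategoryTheory

/-- A multi-graph with vertex set `V` and (undirected) edge set `E`, self-loops and multiple edges
allowed. Every edge is recorded with an arbitrary reference orientation `src e → tgt e`; the edge
can be traversed both ways, see `MultiGraph.Dart`. -/
structure MultiGraph (V E : Type*) where
  src : E → V
  tgt : E → V

namespace MultiGraph

variable {V E V' E' : Type*}

/-- Directed edges: `(e, true)` is `e` with its reference orientation and `(e, false)` is `e` with
the opposite orientation. In particular a self-loop gives two different directed edges. -/
abbrev Dart (_G : MultiGraph V E) : Type _ := E × Bool

/-- The origin of a directed edge. -/
def org (G : MultiGraph V E) (d : G.Dart) : V := cond d.2 (G.src d.1) (G.tgt d.1)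

/-- The terminus of a directed edge. -/
def term (G : MultiGraph V E) (d : G.Dart) : V := cond d.2 (G.tgt d.1) (G.src d.1)

/-- The same edge with the opposite direction. -/
def rev (G : MultiGraph V E) (d : G.Dart) : G.Dart := (d.1, !d.2)

/-- A multi-graph is connected if it is non-empty and any two vertices are joined by a walk. -/
def Connected (G : MultiGraph V E) : Prop :=
  Nonempty V ∧
    ∀ u v : V, Relation.ReflTransGen (fun x y => ∃ d : G.Dart, G.org d = x ∧ G.term d = y) u v

/-- Every vertex is the origin of finitely many directed edges. -/
class LocallyFinite (G : MultiGraph V E) : Prop where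
  finite_darts : ∀ u : V, {d : G.Dart | G.org d = u}.Finite

instance [Finite E] (G : MultiGraph V E) : G.LocallyFinite :=
  ⟨fun _ => Set.toFinite _⟩

/-- The finite set of directed edges with origin `u`. -/
noncomputable def dartsFrom (G : MultiGraph V E) [G.LocallyFinite] (u : V) : Finset G.Dart :=
  (LocallyFinite.finite_darts (G := G) u).toFinset

/-! ### Subgraphs, degree-`k` subgraphs, induced subgraphs -/

/-- A subgraph: a set of vertices and a set of edges all of whose endpoints are among these
vertices. -/
structure Subgraph (G : MultiGraph V E) where
  verts : Finset V
  edges : Finset E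
  src_mem : ∀ e ∈ edges, G.src e ∈ verts
  tgt_mem : ∀ e ∈ edges, G.tgt e ∈ verts

noncomputable instance [Fintype V] [Fintype E] (G : MultiGraph V E) : Fintype G.Subgraph :=
  Fintype.ofInjective (fun S : G.Subgraph => (S.verts, S.edges)) (by
    rintro ⟨a, b, _, _⟩ ⟨c, d, _, _⟩ h
    simp only [Prod.mk.injEq] at h
    obtain ⟨rfl, rfl⟩ := h
    rfl)

/-- The directed edges of a subgraph: its edges with both orientations. -/
def Subgraph.darts {G : MultiGraph V E} (S : G.Subgraph) : Finset G.Dart :=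
  S.edges ×ˢ (Finset.univ : Finset Bool)

open scoped Classical in
/-- The degree of a vertex in a subgraph (a self-loop counts twice). -/
noncomputable def Subgraph.degree {G : MultiGraph V E} (S : G.Subgraph) (v : V) : ℕ :=
  (S.darts.filter fun d => G.org d = v).card

/-- A degree-`k` subgraph: every vertex of the subgraph has degree `k` in the subgraph. The empty
subgraph is a degree-`k` subgraph for every `k`. -/
def Subgraph.IsDegree {G : MultiGraph V E} (S : G.Subgraph) (k : ℕ) : Prop :=
  ∀ v ∈ S.verts, S.degree v = k

/-- A matching is a degree-`1` subgraph. -/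
abbrev Subgraph.IsMatching {G : MultiGraph V E} (S : G.Subgraph) : Prop := S.IsDegree 1

/-- The induced subgraph `G ∖ γ` on the vertices that do not belong to `γ`, as a multi-graph. -/
def delete (G : MultiGraph V E) (γ : G.Subgraph) :
    MultiGraph {v : V // v ∉ γ.verts} {e : E // G.src e ∉ γ.verts ∧ G.tgt e ∉ γ.verts} where
  src e := ⟨G.src e.1, e.2.1⟩
  tgt e := ⟨G.tgt e.1, e.2.2⟩

/-! ### Fundamental group and universal cover -/

/-- The vertices of `G`, as the carrier of the quiver whose arrows are the edges of `G` with their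
reference orientation. -/
def Vertex (_G : MultiGraph V E) : Type _ := V

instance (G : MultiGraph V E) : Quiver G.Vertex where
  Hom u v := {e : E // G.src e = u ∧ G.tgt e = v}

/-- The fundamental groupoid of `G`: the morphisms from `u` to `v` are the walks from `u` to `v`
along directed edges, up to insertion and deletion of backtracks `d d⁻¹`. -/
abbrev FundGroupoid (G : MultiGraph V E) : Type _ := Quiver.FreeGroupoid G.Vertex

/-- A vertex of `G` as an object of the fundamental groupoid. -/
def pt (G : MultiGraph V E) (v : V) : G.FundGroupoid :=
  (Quiver.FreeGroupoid.of G.Vertex).obj v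

/-- The one-step walk along an edge, in its reference orientation. -/
def step (G : MultiGraph V E) (e : E) : G.pt (G.src e) ⟶ G.pt (G.tgt e) :=
  (Quiver.FreeGroupoid.of G.Vertex).map (X := G.src e) (Y := G.tgt e) ⟨e, rfl, rfl⟩

/-- The fundamental group `π₁(G, b)`: homotopy classes of closed walks at `b`. -/
abbrev FundGroup (G : MultiGraph V E) (b : V) : Type _ := End (G.pt b)

/-- Vertices of the universal cover: homotopy classes of walks starting at `b` (each of which
contains exactly one non-backtracking walk). -/
@[ext] structure UnivVertex (G : MultiGraph V E) (b : V) where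
  vert : V
  walk : G.pt b ⟶ G.pt vert

/-- Edges of the universal cover: an edge `e` of `G` with a lift of its source. -/
@[ext] structure UnivEdge (G : MultiGraph V E) (b : V) where
  edge : E
  walk : G.pt b ⟶ G.pt (G.src edge)

/-- The universal cover of (the component of `b` in) `G`. -/
def univCover (G : MultiGraph V E) (b : V) : MultiGraph (G.UnivVertex b) (G.UnivEdge b) where
  src x := ⟨G.src x.edge, x.walk⟩
  tgt x := ⟨G.tgt x.edge, x.walk ≫ G.step x.edge⟩

/-- The action of the fundamental group on the vertices of the universal cover by prepending closed
walks. (Multiplication in `End` is `γ * δ = δ ≫ γ`, so that prepending the inverse of the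
closed walk gives a left action; the orbits are the same.) -/
instance (G : MultiGraph V E) (b : V) : MulAction (G.FundGroup b) (G.UnivVertex b) where
  smul γ x := ⟨x.vert, Groupoid.inv (End.asHom γ) ≫ x.walk⟩
  one_smul x := UnivVertex.ext rfl (heq_of_eq (by
    change Groupoid.inv (𝟙 (G.pt b)) ≫ x.walk = x.walk
    simp))
  mul_smul γ δ x := UnivVertex.ext rfl (heq_of_eq (by
    change Groupoid.inv (End.asHom δ ≫ End.asHom γ) ≫ x.walk =
      Groupoid.inv (End.asHom γ) ≫ Groupoid.inv (End.asHom δ) ≫ x.walk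
    simp))

/-- The corresponding action on the edges of the universal cover. -/
instance (G : MultiGraph V E) (b : V) : MulAction (G.FundGroup b) (G.UnivEdge b) where
  smul γ x := ⟨x.edge, Groupoid.inv (End.asHom γ) ≫ x.walk⟩
  one_smul x := UnivEdge.ext rfl (heq_of_eq (by
    change Groupoid.inv (𝟙 (G.pt b)) ≫ x.walk = x.walk
    simp))
  mul_smul γ δ x := UnivEdge.ext rfl (heq_of_eq (by
    change Groupoid.inv (End.asHom δ ≫ End.asHom γ) ≫ x.walk =
      Groupoid.inv (End.asHom γ) ≫ Groupoid.inv (End.asHom δ) ≫ x.walk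
    simp))

/-! ### The maximal abelian cover -/

/-- Vertices of the maximal abelian cover: orbits of the commutator subgroup `[π₁, π₁]` on the
vertices of the universal cover. -/
abbrev AbVertex (G : MultiGraph V E) (b : V) : Type _ :=
  MulAction.orbitRel.Quotient (commutator (G.FundGroup b)) (G.UnivVertex b)

/-- Edges of the maximal abelian cover: orbits of the commutator subgroup `[π₁, π₁]` on the
edges of the universal cover. -/
abbrev AbEdge (G : MultiGraph V E) (b : V) : Type _ :=
  MulAction.orbitRel.Quotient (commutator (G.FundGroup b)) (G.UnivEdge b)

theorem univCover_tgt_smul (G : MultiGraph V E) (b : V) (γ : G.FundGroup b)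
    (x : G.UnivEdge b) : (G.univCover b).tgt (γ • x) = γ • (G.univCover b).tgt x :=
  UnivVertex.ext rfl (heq_of_eq (Category.assoc _ _ _))

/-- The maximal abelian cover `G^ab`, the quotient of the universal cover by the commutator
subgroup of the fundamental group. -/
def abCover (G : MultiGraph V E) (b : V) : MultiGraph (G.AbVertex b) (G.AbEdge b) where
  src := Quotient.map' (G.univCover b).src (by
    rintro _ y ⟨γ, rfl⟩
    exact ⟨γ, rfl⟩)
  tgt := Quotient.map' (G.univCover b).tgt (by
    rintro _ y ⟨γ, rfl⟩
    exact ⟨γ, (G.univCover_tgt_smul b γ.1 y).symm⟩)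

/-- The covering projection `G^ab → G` on vertices. -/
def abProjV (G : MultiGraph V E) (b : V) : G.AbVertex b → V :=
  Quotient.lift UnivVertex.vert (by
    rintro _ y ⟨γ, rfl⟩
    rfl)

/-- The covering projection `G^ab → G` on edges. -/
def abProjE (G : MultiGraph V E) (b : V) : G.AbEdge b → E :=
  Quotient.lift UnivEdge.edge (by
    rintro _ y ⟨γ, rfl⟩
    rfl)

instance [Finite E] (G : MultiGraph V E) (b : V) : (G.abCover b).LocallyFinite where
  finite_darts u := by
    refine Set.Finite.of_finite_image
      (f := fun d : (G.abCover b).Dart => (G.abProjE b d.1, d.2)) (Set.toFinite _) ?_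
    rintro ⟨q₁, s⟩ h₁ ⟨q₂, t⟩ h₂ h
    induction q₁ using Quotient.inductionOn' with
    | _ x₁ =>
    induction q₂ using Quotient.inductionOn' with
    | _ x₂ =>
    obtain ⟨e₁, p₁⟩ := x₁
    obtain ⟨e₂, p₂⟩ := x₂
    simp only [Prod.mk.injEq] at h
    obtain ⟨he, rfl⟩ := h
    change e₁ = e₂ at he
    subst he
    have h₃ := h₁.trans h₂.symm
    refine Prod.ext (Quotient.sound' ?_) rfl
    cases s with
    | true =>
      obtain ⟨γ, hγ⟩ := Quotient.exact h₃
      exact ⟨γ, UnivEdge.ext rfl (heq_of_eq (eq_of_heq (UnivVertex.mk.inj hγ).2))⟩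
    | false =>
      obtain ⟨γ, hγ⟩ := Quotient.exact h₃
      refine ⟨γ, UnivEdge.ext rfl (heq_of_eq ?_)⟩
      have h₄ := eq_of_heq (UnivVertex.mk.inj hγ).2
      change Groupoid.inv (End.asHom γ.1) ≫ p₂ ≫ G.step e₁ = p₁ ≫ G.step e₁ at h₄
      rw [← Category.assoc] at h₄
      exact (cancel_mono _).1 h₄

end MultiGraph

/-! ### Schrödinger operators -/

/-- A Schrödinger operator on `G`: non-zero complex weights `w_d` on the directed edges with
`w_d = conj w_{d⁻¹}`, and a real potential on the vertices. -/
structure SchrodingerOperator {V E : Type*} (G : MultiGraph V E) where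
  weight : G.Dart → ℂ
  weight_rev : ∀ d, weight (G.rev d) = (starRingEnd ℂ) (weight d)
  weight_ne_zero : ∀ d, weight d ≠ 0
  potential : V → ℝ

namespace SchrodingerOperator

variable {V E : Type*} {G : MultiGraph V E}

/-- The action on functions,
`(H f)(u) = ∑_{d : org d = u} w_d f(term d) + 𝒱_u f(u)`. Equivalently, the `(u, v)` matrix entry
of `H` is the sum of `w_d` over the directed edges `d` from `u` to `v`, plus `𝒱_u` if `u = v`. -/
noncomputable def op (H : SchrodingerOperator G) [G.LocallyFinite] : (V → ℂ) →ₗ[ℂ] (V → ℂ) where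
  toFun f u := ∑ d ∈ G.dartsFrom u, H.weight d * f (G.term d) + (H.potential u : ℂ) * f u
  map_add' f g := by
    ext u
    simp only [Pi.add_apply, mul_add, Finset.sum_add_distrib]
    ring
  map_smul' c f := by
    ext u
    simp only [Pi.smul_apply, smul_eq_mul, RingHom.id_apply, mul_add, Finset.mul_sum]
    congr 1
    · exact Finset.sum_congr rfl fun _ _ => by ring
    · ring

/-- `lam` is an eigenvalue of `H` on `ℓ²(V)`: there is a non-zero square-summable `f : V → ℂ` with
`H f = lam f`. -/
def HasL2Eigenvalue (H : SchrodingerOperator G) [G.LocallyFinite] (lam : ℝ) : Prop :=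
  ∃ f : V → ℂ, Memℓp f 2 ∧ f ≠ 0 ∧ H.op f = (lam : ℂ) • f

/-- The pull-back `H^ab` of `H` to the maximal abelian cover. -/
def ab (H : SchrodingerOperator G) (b : V) : SchrodingerOperator (G.abCover b) where
  weight d := H.weight (G.abProjE b d.1, d.2)
  weight_rev d := H.weight_rev (G.abProjE b d.1, d.2)
  weight_ne_zero _ := H.weight_ne_zero _
  potential x := H.potential (G.abProjV b x)

/-- The restriction of `H` to the induced subgraph `G ∖ γ`. -/
def delete (H : SchrodingerOperator G) (γ : G.Subgraph) : SchrodingerOperator (G.delete γ) where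
  weight d := H.weight (d.1.1, d.2)
  weight_rev d := H.weight_rev (d.1.1, d.2)
  weight_ne_zero _ := H.weight_ne_zero _
  potential x := H.potential x.1

open scoped Classical in
/-- The generalized matching polynomial
`∑_M (-1)^(|V_M| / 2) ∏_{d ∈ darts of M} w_d ∏_{u ∉ V_M} (X - 𝒱_u)`, the sum being over all
matchings `M` (for which `|V_M|` is even). -/
noncomputable def matchingPolynomial [Fintype V] [Fintype E] (H : SchrodingerOperator G) :
    Polynomial ℂ :=
  ∑ M : G.Subgraph with M.IsMatching,
    (-1) ^ (M.verts.card / 2) * Polynomial.C (∏ d ∈ M.darts, H.weight d) *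
      ∏ u ∈ Finset.univ \ M.verts, (Polynomial.X - Polynomial.C (H.potential u : ℂ))

open scoped Classical in
/-- The generalized matching polynomial of `G ∖ γ` with respect to the restriction of `H`. -/
noncomputable def matchingPolynomialDelete [Fintype V] [Fintype E] (H : SchrodingerOperator G)
    (γ : G.Subgraph) : Polynomial ℂ :=
  (H.delete γ).matchingPolynomial

end SchrodingerOperator

/-! The maximal abelian cover is a component of the lattice `V × ℤ^E`: a walk from `b` is recorded
by its endpoint and its signed edge counts, and since `G` is connected these determine it up to
`[π₁, π₁]`. Translations by `ℤ^E` move any lattice point into this component, so `H^ab` has the same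
ℓ² eigenvalues as the periodic operator on the lattice (`hasL2Eigenvalue_ab_iff`).

By periodicity, λ minus this operator is a `V × V` matrix over the group ring `ℂ[ℤ^E]`, and λ is an
eigenvalue exactly when its determinant vanishes (`exists_lattice_eigenfunction_iff`). If the
determinant is zero, a kernel vector over the domain `ℂ[ℤ^E]` is a finitely supported eigenfunction.
If not, the adjugate shows that the determinant annihilates every component of an ℓ² eigenfunction;
on the Fourier side it is a non-zero trigonometric polynomial, hence non-zero almost everywhere, and
the eigenfunction is zero.

In the permutation expansion of the determinant, an edge used in both directions is a matching edge
and the remaining directed edges form an oriented degree-2 subgraph `O` (`det_dartMatrix`). Matching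
edges do not affect the exponent, whereas `O` can be read off from its exponent. Nothing cancels
between different `O`: the coefficient at `O` is a non-zero number times the matching polynomial of
the complement of `O` at λ. This is 1 ⇔ 2.

For 2 ⇔ 3, the same expansion with scalar weights writes the characteristic polynomial of `G ∖ γ` as
a combination of matching polynomials of `G ∖ (γ ∪ γ')`, with `γ'` disjoint from `γ`. The system is
triangular for inclusion, so all these determinants vanish at λ iff all the matching polynomials do
(`forall_matchingSum_eq_zero_iff_forall_det`). -/

/-! ### Zero sets of trigonometric polynomials -/

section TrigPolynomial

open MeasureTheory UnitAddTorus

/-- The circle with its normalised Haar measure, as used for `UnitAddTorus.mFourierBasis`. -/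
noncomputable local instance : MeasureSpace UnitAddCircle := ⟨AddCircle.haarAddCircle⟩

local instance : Measure.IsAddHaarMeasure (volume : Measure UnitAddCircle) :=
  inferInstanceAs (Measure.IsAddHaarMeasure AddCircle.haarAddCircle)

local instance : IsProbabilityMeasure (volume : Measure UnitAddCircle) :=
  inferInstanceAs (IsProbabilityMeasure AddCircle.haarAddCircle)

theorem UnitAddCircle.measure_finite_eq_zero {S : Set UnitAddCircle} (hS : S.Finite) :
    (volume : Measure UnitAddCircle) S = 0 := by
  have : Nontrivial UnitAddCircle :=
    ⟨⟨(AddCircle.equivIco (1 : ℝ) 0).symm ⟨0, by norm_num, by norm_num⟩,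
      (AddCircle.equivIco (1 : ℝ) 0).symm ⟨1 / 2, by norm_num, by norm_num⟩, fun h => by
      have h' := congrArg (fun x => ((AddCircle.equivIco (1 : ℝ) 0) x : ℝ)) h
      simp at h'⟩⟩
  have : NullSingletonClass (volume : Measure UnitAddCircle) :=
    inferInstanceAs (NullSingletonClass (AddCircle.haarAddCircle (T := 1)))
  exact hS.measure_zero _

/-- The product of the linear forms `a ↦ (p - q) · a` over distinct `p, q` in `s` is a non-zero
polynomial, so it is non-zero at some integer point. Restricting to a line in direction `a` then
keeps the frequencies distinct. -/
theorem exists_dot_injOn {d : Type*} [Fintype d] (s : Finset (d → ℤ)) :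
    ∃ a : d → ℤ, Set.InjOn (fun m : d → ℤ => ∑ i, m i * a i) s := by
  classical
  let Q : MvPolynomial d ℤ := ∏ p ∈ (s ×ˢ s).filter (fun p => p.1 ≠ p.2),
    ∑ i, MvPolynomial.C (p.1 i - p.2 i) * MvPolynomial.X i
  have hQ : Q ≠ 0 := by
    refine Finset.prod_ne_zero_iff.2 fun p hp h0 => (Finset.mem_filter.1 hp).2 ?_
    funext i
    have := congrArg (MvPolynomial.eval (Pi.single i (1 : ℤ))) h0
    simp [Pi.single_apply] at this
    omega
  obtain ⟨a, ha⟩ : ∃ a, MvPolynomial.eval a Q ≠ 0 := by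
    by_contra! h
    exact hQ (MvPolynomial.funext fun x => by simpa using h x)
  refine ⟨a, fun m hm n hn hmn => ?_⟩
  by_contra hne
  rw [map_prod, Finset.prod_ne_zero_iff] at ha
  refine ha (m, n) (by simp_all) ?_
  simp only [map_sum, map_mul, MvPolynomial.eval_C, MvPolynomial.eval_X, sub_mul,
    Finset.sum_sub_distrib]
  exact sub_eq_zero.2 hmn

/-- After multiplication by a high power of `z`, the sum is a non-zero polynomial in the point `z`
of the unit circle, and has finitely many roots. -/
theorem finite_setOf_trigSum_eq_zero {ι : Type*} (s : Finset ι) (k : ι → ℤ)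
    (hk : Set.InjOn k s) (c : ι → ℂ) {j : ι} (hj : j ∈ s) (hc : c j ≠ 0) :
    {t : UnitAddCircle | ∑ i ∈ s, c i * fourier (k i) t = 0}.Finite := by
  classical
  obtain ⟨N, hN⟩ : ∃ N : ℤ, ∀ i ∈ s, 0 ≤ k i + N := by
    refine ⟨∑ i ∈ s, |k i|, fun i hi => ?_⟩
    have h1 : |k i| ≤ ∑ i ∈ s, |k i| :=
      Finset.single_le_sum (f := fun i => |k i|) (fun i _ => abs_nonneg _) hi
    have h2 := neg_abs_le (k i)
    linarith
  let q : Polynomial ℂ := ∑ i ∈ s, Polynomial.monomial (k i + N).toNat (c i)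
  have hq : q ≠ 0 := by
    intro h0
    have h1 : q.coeff (k j + N).toNat = c j := by
      simp only [q, Polynomial.finsetSum_coeff, Polynomial.coeff_monomial]
      rw [Finset.sum_eq_single_of_mem j hj]
      · simp
      · intro i hi hij
        rw [if_neg]
        intro h
        refine hij (hk hi hj ?_)
        have := hN i hi
        have := hN j hj
        omega
    exact hc (by rw [← h1, h0, Polynomial.coeff_zero])
  have hinj : Function.Injective fun t : UnitAddCircle => (AddCircle.toCircle t : ℂ) :=
    Subtype.val_injective.comp (AddCircle.injective_toCircle one_ne_zero)
  refine Set.Finite.of_finite_image (f := fun t : UnitAddCircle => (AddCircle.toCircle t : ℂ))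
    (Set.Finite.subset q.roots.toFinset.finite_toSet ?_) hinj.injOn
  rintro _ ⟨t, ht, rfl⟩
  simp only [Finset.mem_coe, Multiset.mem_toFinset, Polynomial.mem_roots hq, Polynomial.IsRoot]
  have ht' : ∑ i ∈ s, c i * fourier (k i) t = 0 := ht
  have hz : (AddCircle.toCircle t : ℂ) ≠ 0 := Circle.coe_ne_zero _
  have : q.eval (AddCircle.toCircle t : ℂ) =
      (AddCircle.toCircle t : ℂ) ^ N * ∑ i ∈ s, c i * fourier (k i) t := by
    simp only [q, Polynomial.eval_finsetSum, Polynomial.eval_monomial, Finset.mul_sum]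
    refine Finset.sum_congr rfl fun i hi => ?_
    rw [fourier_apply, AddCircle.toCircle_zsmul, Circle.coe_zpow, mul_left_comm, ← zpow_add₀ hz,
      ← zpow_natCast, Int.toNat_of_nonneg (hN i hi), add_comm]
  rw [this, ht', mul_zero]

theorem mFourier_add_zsmul {d : Type*} [Fintype d] (m a : d → ℤ) (t : UnitAddTorus d)
    (s : UnitAddCircle) :
    mFourier m (t + fun i => a i • s) = mFourier m t * fourier (∑ i, m i * a i) s := by
  have : (fourier (∑ i, m i * a i) s : ℂ) = ∏ i, fourier (m i) (a i • s) := by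
    simp only [fourier_apply, ← mul_smul]
    rw [Finset.sum_smul]
    induction (Finset.univ : Finset d) using Finset.cons_induction with
    | empty => simp
    | cons i s hi ih => simp [AddCircle.toCircle_add, ih]
  rw [this]
  simp only [mFourier, ContinuousMap.coe_mk, ← Finset.prod_mul_distrib]
  refine Finset.prod_congr rfl fun i _ => ?_
  simp [fourier_apply, smul_add, AddCircle.toCircle_add]

/-- A non-zero trigonometric polynomial is almost everywhere non-zero. -/
theorem ae_trigPolynomial_ne_zero {d : Type*} [Fintype d] (s : Finset (d → ℤ)) (c : (d → ℤ) → ℂ)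
    {m : d → ℤ} (hm : m ∈ s) (hc : c m ≠ 0) :
    ∀ᵐ t : UnitAddTorus d, ∑ n ∈ s, c n * mFourier n t ≠ 0 := by
  -- On every line `r ↦ t + r a` the zeros are finite in number. By Fubini some fixed `r` works for
  -- almost all `t`, and translation invariance removes this `r`.
  obtain ⟨a, ha⟩ := exists_dot_injOn s
  have hcont : Continuous fun t : UnitAddTorus d => ∑ n ∈ s, c n * mFourier n t := by fun_prop
  have h1 : ∀ t : UnitAddTorus d, ∀ᵐ r : UnitAddCircle,
      ∑ n ∈ s, c n * mFourier n (t + fun i => a i • r) ≠ 0 := by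
    intro t
    rw [ae_iff]
    simp only [not_not, mFourier_add_zsmul, ← mul_assoc]
    refine UnitAddCircle.measure_finite_eq_zero
      (finite_setOf_trigSum_eq_zero s _ ha (fun n => c n * mFourier n t) hm ?_)
    refine mul_ne_zero hc ?_
    simp only [mFourier, ContinuousMap.coe_mk, fourier_apply]
    exact Finset.prod_ne_zero_iff.2 fun i _ => Circle.coe_ne_zero _
  have h2 : ∀ᵐ r : UnitAddCircle, ∀ᵐ t : UnitAddTorus d,
      ∑ n ∈ s, c n * mFourier n (t + fun i => a i • r) ≠ 0 := by
    refine (Measure.ae_ae_comm ?_).1 (Filter.Eventually.of_forall h1)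
    refine (isOpen_ne.preimage (hcont.comp ?_)).measurableSet
    fun_prop
  obtain ⟨r, hr⟩ := h2.exists
  have h3 := (measurePreserving_add_right (volume : Measure (UnitAddTorus d))
    (fun i => - (a i • r))).quasiMeasurePreserving.ae hr
  filter_upwards [h3] with t ht
  convert ht using 4
  funext i
  simp

/-- Non-zero trigonometric polynomials are not zero divisors on `ℓ²(ℤ^d)`. -/
theorem eq_zero_of_sum_shift_eq_zero {d : Type*} [Fintype d] (s : Finset (d → ℤ))
    (c : (d → ℤ) → ℂ) {m : d → ℤ} (hm : m ∈ s) (hc : c m ≠ 0) (f : (d → ℤ) → ℂ)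
    (hf : Memℓp f 2) (h : ∀ n, ∑ k ∈ s, c k * f (n + k) = 0) : f = 0 := by
  classical
  let F : Lp ℂ 2 (volume : Measure (UnitAddTorus d)) := mFourierBasis.repr.symm ⟨f, hf⟩
  have hF : ∀ n, mFourierCoeff F n = f n := by
    intro n
    rw [← mFourierBasis_repr]
    simp [F]
  -- Multiplication by the character `-k` turns the coefficient at `n` into the one at `n + k`, so
  -- the hypothesis says that all Fourier coefficients of `P F` vanish.
  let P : C(UnitAddTorus d, ℂ) := ∑ k ∈ s, c k • mFourier (-k)
  have hP : ∀ t, P t = ∑ k ∈ s, c k * mFourier (-k) t := fun t => by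
    simp [P, ContinuousMap.sum_apply]
  have hFm : MemLp F 2 (volume : Measure (UnitAddTorus d)) := Lp.memLp F
  have hFi : Integrable F (volume : Measure (UnitAddTorus d)) := hFm.integrable (by norm_num)
  have hPF : MemLp (fun t => P t * F t) 2 (volume : Measure (UnitAddTorus d)) := by
    refine MemLp.of_le_mul (c := ‖P‖) hFm
      (P.continuous.aestronglyMeasurable.mul hFm.aestronglyMeasurable) ?_
    filter_upwards with t
    rw [norm_mul]
    gcongr
    exact P.norm_coe_le_norm t
  have hcoef : ∀ n, mFourierCoeff (fun t => P t * F t) n = 0 := by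
    intro n
    rw [← h n]
    simp only [mFourierCoeff, hP, smul_eq_mul, Finset.sum_mul, Finset.mul_sum]
    rw [integral_finsetSum]
    · refine Finset.sum_congr rfl fun k _ => ?_
      rw [← hF, mFourierCoeff, ← integral_const_mul]
      refine integral_congr_ae (Filter.Eventually.of_forall fun t => ?_)
      simp only [neg_add, mFourier_add, smul_eq_mul]
      ring
    · intro k _
      refine (hFi.bdd_mul (c := ‖c k‖) (f := fun t => mFourier (-n) t * (c k * mFourier (-k) t))
        (by fun_prop) ?_).congr (Filter.Eventually.of_forall fun t => ?_)
      · filter_upwards with t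
        rw [norm_mul, norm_mul]
        have h1 := (mFourier (-n)).norm_coe_le_norm t
        have h2 := (mFourier (-k)).norm_coe_le_norm t
        rw [mFourier_norm] at h1 h2
        calc _ ≤ 1 * (‖c k‖ * 1) := by gcongr
          _ = _ := by ring
      · simp only [mul_assoc]
  have hzero : hPF.toLp = 0 := by
    apply mFourierBasis.repr.injective
    ext n
    rw [mFourierBasis_repr, map_zero]
    rw [show mFourierCoeff (⇑hPF.toLp) n = mFourierCoeff (fun t => P t * F t) n from
      integral_congr_ae (by
        filter_upwards [hPF.coeFn_toLp] with t ht
        rw [ht])]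
    rw [hcoef]
    rfl
  have hae : ∀ᵐ t : UnitAddTorus d, P t * F t = 0 := by
    filter_upwards [hPF.coeFn_toLp, Lp.coeFn_zero ℂ 2 (volume : Measure (UnitAddTorus d))]
      with t h1 h2
    rw [← h1, hzero, h2]
    rfl
  have hne : ∀ᵐ t : UnitAddTorus d, P t ≠ 0 := by
    have := ae_trigPolynomial_ne_zero (s.map (Equiv.neg (d → ℤ)).toEmbedding) (fun k => c (-k))
      (m := -m) (by simpa using hm) (by simpa using hc)
    filter_upwards [this] with t ht
    rw [hP]
    simpa using ht
  have hF0 : F =ᵐ[volume] 0 := by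
    filter_upwards [hae, hne] with t h1 h2
    exact (mul_eq_zero.1 h1).resolve_left h2
  funext n
  rw [← hF n, mFourierCoeff, integral_congr_ae (g := fun _ => 0)]
  · simp
  · filter_upwards [hF0] with t ht
    simp [ht]

end TrigPolynomial

/-! ### Expansion of determinants over oriented degree-2 subgraphs and matchings -/

section SelfMapSign

open scoped Classical

variable {V : Type*} [Fintype V]

/-- The determinant of the 0-1 matrix of a self-map; this is the sign if the map is bijective
and zero otherwise. -/
noncomputable def selfMapSign (N : V → V) : ℤ :=
  ((1 : Matrix V V ℤ).submatrix N id).det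

theorem selfMapSign_comp (N N' : V → V) :
    selfMapSign (N ∘ N') = selfMapSign N' * selfMapSign N := by
  rw [selfMapSign, selfMapSign, selfMapSign, ← Matrix.det_mul]
  congr 1
  ext u v
  rw [Matrix.mul_apply, Finset.sum_eq_single (N' u)]
  · simp [Matrix.one_apply]
  · intro w _ hw
    simp [Matrix.one_apply, hw.symm]
  · simp

theorem selfMapSign_perm (σ : Equiv.Perm V) : selfMapSign σ = Equiv.Perm.sign σ := by
  rw [selfMapSign, Matrix.det_permute]
  simp

theorem selfMapSign_eq_zero {N : V → V} (hN : ¬ Function.Injective N) : selfMapSign N = 0 := by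
  simp only [Function.Injective, not_forall] at hN
  obtain ⟨u, v, huv, hne⟩ := hN
  refine Matrix.det_zero_of_row_eq hne ?_
  ext w
  rw [Matrix.submatrix_apply, Matrix.submatrix_apply, huv]

theorem selfMapSign_ne_zero {N : V → V} (hN : Function.Injective N) : selfMapSign N ≠ 0 := by
  have := selfMapSign_perm (Equiv.ofBijective N (Finite.injective_iff_bijective.1 hN))
  rw [Equiv.coe_ofBijective] at this
  rw [this]
  exact Units.ne_zero _

theorem selfMapSign_cast {R : Type*} [CommRing R] (N : V → V) :
    (selfMapSign N : R) = ((1 : Matrix V V R).submatrix N id).det := by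
  rw [selfMapSign, ← eq_intCast (Int.castRingHom R), RingHom.map_det]
  congr 1
  ext u v
  by_cases h : N u = v <;> simp [Matrix.one_apply, h]

end SelfMapSign

namespace MultiGraph

open scoped Classical

variable {V E : Type*} (G : MultiGraph V E)

@[simp] theorem org_rev (d : G.Dart) : G.org (G.rev d) = G.term d := by
  obtain ⟨e, _ | _⟩ := d <;> rfl

@[simp] theorem term_rev (d : G.Dart) : G.term (G.rev d) = G.org d := by
  obtain ⟨e, _ | _⟩ := d <;> rfl

@[simp] theorem rev_rev (d : G.Dart) : G.rev (G.rev d) = d := by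
  obtain ⟨e, _ | _⟩ := d <;> rfl

theorem rev_ne (d : G.Dart) : G.rev d ≠ d := by
  obtain ⟨e, _ | _⟩ := d <;> simp [rev]

/-- Both orientations of the edges in `M`. -/
abbrev bothDarts (M : Finset E) : Finset G.Dart := M ×ˢ (Finset.univ : Finset Bool)

theorem rev_mem_bothDarts {M : Finset E} {d : G.Dart} :
    G.rev d ∈ G.bothDarts M ↔ d ∈ G.bothDarts M := by
  simp [rev]

/-- A set of directed edges that describes a permutation of the vertices: at each vertex at most one
of them starts and at most one of them ends, and the origins and termini are the same vertices. -/
structure Permutes (S : Finset G.Dart) : Prop where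
  injOn_org : Set.InjOn G.org S
  injOn_term : Set.InjOn G.term S
  image_eq : S.image G.org = S.image G.term

/-- The map that moves vertices along the directed edges in `S`. -/
noncomputable def move (S : Finset G.Dart) (u : V) : V :=
  if h : ∃ d ∈ S, G.org d = u then G.term h.choose else u

variable {G}

theorem move_org {S : Finset G.Dart} (hS : Set.InjOn G.org S) {d : G.Dart} (hd : d ∈ S) :
    G.move S (G.org d) = G.term d := by
  have h : ∃ d' ∈ S, G.org d' = G.org d := ⟨d, hd, rfl⟩
  rw [move, dif_pos h, hS h.choose_spec.1 hd h.choose_spec.2]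

theorem move_of_notMem {S : Finset G.Dart} {u : V} (h : u ∉ S.image G.org) : G.move S u = u := by
  rw [move, dif_neg]
  simpa using h

theorem Permutes.injective_move {S : Finset G.Dart} (hS : G.Permutes S) :
    Function.Injective (G.move S) := by
  have key : ∀ d ∈ S, ∀ v, G.move S (G.org d) = G.move S v → G.org d = v := by
    intro d hd v h
    rw [move_org hS.injOn_org hd] at h
    by_cases hv : v ∈ S.image G.org
    · obtain ⟨d', hd', rfl⟩ := Finset.mem_image.1 hv
      rw [move_org hS.injOn_org hd'] at h
      rw [hS.injOn_term hd hd' h]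
    · rw [move_of_notMem hv] at h
      rw [hS.image_eq] at hv
      exact absurd (Finset.mem_image.2 ⟨d, hd, h⟩) hv
  intro u v h
  by_cases hu : u ∈ S.image G.org
  · obtain ⟨d, hd, rfl⟩ := Finset.mem_image.1 hu
    exact key d hd v h
  by_cases hv : v ∈ S.image G.org
  · obtain ⟨d, hd, rfl⟩ := Finset.mem_image.1 hv
    exact (key d hd u h.symm).symm
  rwa [move_of_notMem hu, move_of_notMem hv] at h

/-- A terminus that is not an origin would be fixed by `move S` and also be the image of another
vertex. So the termini are among the origins, and counting gives equality. -/
theorem permutes_of_injective_move {S : Finset G.Dart} (hS : Set.InjOn G.org S)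
    (h : Function.Injective (G.move S)) : G.Permutes S := by
  have hterm : Set.InjOn G.term S := by
    intro d hd d' hd' hdd
    refine hS hd hd' (h ?_)
    rw [move_org hS hd, move_org hS hd', hdd]
  refine ⟨hS, hterm, (Finset.eq_of_subset_of_card_le ?_ ?_).symm⟩
  · intro v hv
    obtain ⟨d, hd, rfl⟩ := Finset.mem_image.1 hv
    by_contra hn
    refine hn ?_
    have h1 : G.move S (G.term d) = G.move S (G.org d) := by
      rw [move_of_notMem hn, move_org hS hd]
    rw [h h1]
    exact Finset.mem_image_of_mem _ hd
  · rw [Finset.card_image_of_injOn hS, Finset.card_image_of_injOn hterm]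

section Determinant

variable [Fintype V] [Fintype E] {R : Type*} [CommRing R]

/-- The matrix with diagonal `c` from which the weighted adjacency matrix of `a` is subtracted. -/
noncomputable def dartMatrix (G : MultiGraph V E) (a : G.Dart → R) (c : V → R) : Matrix V V R :=
  fun u v => (if u = v then c u else 0) -
    ∑ d : G.Dart, if G.org d = u ∧ G.term d = v then a d else 0

/-- Row `u` is a sum over `Option G.Dart`: `none` for the diagonal term, `some d` for a directed
edge leaving `u`. Multilinearity expands the determinant over all choices, and the surviving choices
are the sets that permute the vertices. -/
theorem det_dartMatrix_eq_sum_permutes (a : G.Dart → R) (c : V → R) :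
    (G.dartMatrix a c).det = ∑ S : Finset G.Dart with G.Permutes S,
      (selfMapSign (G.move S) : R) * (∏ d ∈ S, -a d) * ∏ u ∈ Finset.univ \ S.image G.org, c u := by
  let r : V → Option G.Dart → V → R := fun u o => match o with
    | none => c u • Pi.single u 1
    | some d => if G.org d = u then (-a d) • Pi.single (G.term d) 1 else 0
  have hrow : G.dartMatrix a c = fun u => ∑ o, r u o := by
    ext u v
    rw [Fintype.sum_option]
    simp only [dartMatrix, r, Pi.add_apply, Pi.smul_apply, Finset.sum_apply, sub_eq_add_neg,
      ← Finset.sum_neg_distrib]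
    congr 1
    · simp [Pi.single_apply, eq_comm]
    · refine Finset.sum_congr rfl fun d _ => ?_
      by_cases h : G.org d = u <;> by_cases h' : G.term d = v <;>
        simp [h, h']
  have hexp : (G.dartMatrix a c).det =
      ∑ φ : V → Option G.Dart, Matrix.det (fun u => r u (φ u)) := by
    rw [hrow]
    exact (Matrix.detRowAlternating (n := V) (R := R)).toMultilinearMap.map_sum r
  rw [hexp]
  let φ : Finset G.Dart → V → Option G.Dart := fun S u =>
    if h : ∃ d ∈ S, G.org d = u then some h.choose else none
  have hφ_org : ∀ S : Finset G.Dart, Set.InjOn G.org S → ∀ d ∈ S, φ S (G.org d) = some d := by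
    intro S hS d hd
    have h : ∃ d' ∈ S, G.org d' = G.org d := ⟨d, hd, rfl⟩
    simp only [φ]
    rw [dif_pos h, hS h.choose_spec.1 hd h.choose_spec.2]
  have hφ_none : ∀ S : Finset G.Dart, ∀ u ∉ S.image G.org, φ S u = none := by
    intro S u hu
    simp only [φ]
    rw [dif_neg]
    simpa using hu
  have hφ_some : ∀ (S : Finset G.Dart) u d, φ S u = some d → d ∈ S ∧ G.org d = u := by
    intro S u d h
    simp only [φ] at h
    split_ifs at h with h'
    obtain rfl := Option.some.inj h
    exact h'.choose_spec
  have hval : ∀ S : Finset G.Dart, Set.InjOn G.org S → Matrix.det (fun u => r u (φ S u)) =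
      (selfMapSign (G.move S) : R) * (∏ d ∈ S, -a d) *
        ∏ u ∈ Finset.univ \ S.image G.org, c u := by
    intro S hS
    let k : V → R := fun u => match φ S u with
      | none => c u
      | some d => -a d
    have h1 : (fun u => r u (φ S u)) =
        Matrix.of fun u v => k u * (1 : Matrix V V R).submatrix (G.move S) id u v := by
      ext u v
      by_cases hu : u ∈ S.image G.org
      · obtain ⟨d, hd, rfl⟩ := Finset.mem_image.1 hu
        simp only [r, k, hφ_org S hS d hd, move_org hS hd, if_true, Matrix.submatrix_apply,
          Matrix.one_apply, Pi.smul_apply, Pi.single_apply, smul_eq_mul, id_eq, Matrix.of_apply,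
          eq_comm]
      · simp [r, k, hφ_none S u hu, move_of_notMem hu, Matrix.one_apply, Pi.single_apply, eq_comm]
    rw [h1, Matrix.det_mul_column, selfMapSign_cast, mul_comm, mul_assoc]
    congr 1
    rw [← Finset.prod_sdiff (Finset.subset_univ (S.image G.org)), mul_comm,
      Finset.prod_image hS]
    congr 1
    · refine Finset.prod_congr rfl fun d hd => ?_
      simp only [k, hφ_org S hS d hd]
    · refine Finset.prod_congr rfl fun u hu => ?_
      simp only [k, hφ_none S u (Finset.mem_sdiff.1 hu).2]
  symm
  refine Finset.sum_of_injOn φ ?_ (fun _ _ => Finset.mem_coe.2 (Finset.mem_univ _)) ?_ ?_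
  · intro S hS T hT hST
    have hS' := (Finset.mem_filter.1 hS).2
    have hT' := (Finset.mem_filter.1 hT).2
    ext d
    constructor
    · intro hd
      have := hφ_org S hS'.injOn_org d hd
      rw [hST] at this
      exact (hφ_some T _ _ this).1
    · intro hd
      have := hφ_org T hT'.injOn_org d hd
      rw [← hST] at this
      exact (hφ_some S _ _ this).1
  · intro ψ _ hψ
    -- A remaining choice either selects at some `u` a directed edge not leaving `u`, giving a zero
    -- row, or comes from a set whose `move` is not injective, whose sign is zero.
    by_cases hv : ∀ u d, ψ u = some d → G.org d = u
    · let S : Finset G.Dart := Finset.univ.filter fun d => ψ (G.org d) = some d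
      have hS : Set.InjOn G.org S := by
        intro d hd d' hd' h
        have h1 := (Finset.mem_filter.1 hd).2
        have h2 := (Finset.mem_filter.1 hd').2
        rw [h, h2] at h1
        exact (Option.some.inj h1).symm
      have hψS : φ S = ψ := by
        funext u
        cases hu : ψ u with
        | none =>
          refine hφ_none S u fun h => ?_
          obtain ⟨d, hd, rfl⟩ := Finset.mem_image.1 h
          rw [(Finset.mem_filter.1 hd).2] at hu
          exact absurd hu (by simp)
        | some d =>
          obtain rfl := hv u d hu
          exact hφ_org S hS d (Finset.mem_filter.2 ⟨Finset.mem_univ _, hu⟩)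
      rw [← hψS, hval S hS, selfMapSign_eq_zero]
      · simp
      · intro hinj
        exact hψ ⟨S, by simpa using permutes_of_injective_move hS hinj, hψS⟩
    · push Not at hv
      obtain ⟨u, d, hu, hd⟩ := hv
      refine Matrix.det_eq_zero_of_row_eq_zero u fun v => ?_
      simp [r, hu, hd]
  · intro S hS
    exact (hval S (Finset.mem_filter.1 hS).2.injOn_org).symm

end Determinant

end MultiGraph

/-! ### Splitting a permutation into matching edges and an oriented part -/

namespace MultiGraph

open scoped Classical

variable {V E : Type*} {G : MultiGraph V E}

/-- A set of directed edges that permutes the vertices and contains no directed edge together with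
its reversal: an oriented degree-2 subgraph. -/
structure Oriented (O : Finset G.Dart) : Prop extends G.Permutes O where
  rev_notMem : ∀ d ∈ O, G.rev d ∉ O

theorem bothDarts_insert (e : E) (M : Finset E) : G.bothDarts (insert e M) =
    insert (e, true) (insert (e, false) (G.bothDarts M)) := by
  ext ⟨e', s⟩
  cases s <;> simp

theorem image_term_bothDarts (M : Finset E) :
    (G.bothDarts M).image G.term = (G.bothDarts M).image G.org := by
  ext v
  simp only [Finset.mem_image]
  constructor
  · rintro ⟨d, hd, rfl⟩
    exact ⟨G.rev d, G.rev_mem_bothDarts.2 hd, G.org_rev d⟩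
  · rintro ⟨d, hd, rfl⟩
    exact ⟨G.rev d, G.rev_mem_bothDarts.2 hd, G.term_rev d⟩

theorem Permutes.bothDarts {M : Finset E} (h : Set.InjOn G.org (G.bothDarts M)) :
    G.Permutes (G.bothDarts M) := by
  refine ⟨h, fun d hd d' hd' hdd => ?_, (image_term_bothDarts M).symm⟩
  rw [← G.org_rev, ← G.org_rev] at hdd
  have := h (G.rev_mem_bothDarts.2 hd) (G.rev_mem_bothDarts.2 hd') hdd
  rw [← G.rev_rev d, this, G.rev_rev]

theorem injOn_union_iff {α β : Type*} [DecidableEq α] [DecidableEq β] {f : α → β}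
    {S T : Finset α} (hST : Disjoint S T) :
    Set.InjOn f ↑(S ∪ T) ↔
      Set.InjOn f S ∧ Set.InjOn f T ∧ Disjoint (S.image f) (T.image f) := by
  rw [Finset.coe_union, Set.injOn_union (Finset.disjoint_coe.2 hST), ← Finset.disjoint_coe,
    Finset.coe_image, Finset.coe_image, Set.disjoint_iff_forall_ne]
  simp only [Set.forall_mem_image]

theorem disjoint_of_disjoint_image {α β : Type*} [DecidableEq β] {f : α → β} {S T : Finset α}
    (h : Disjoint (S.image f) (T.image f)) : Disjoint S T := by
  rw [Finset.disjoint_left] at h ⊢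
  exact fun x hx hx' => h (Finset.mem_image_of_mem f hx) (Finset.mem_image_of_mem f hx')

theorem Permutes.union {S T : Finset G.Dart} (hS : G.Permutes S) (hT : G.Permutes T)
    (h : Disjoint (S.image G.org) (T.image G.org)) : G.Permutes (S ∪ T) where
  injOn_org := (injOn_union_iff (disjoint_of_disjoint_image h)).2 ⟨hS.1, hT.1, h⟩
  injOn_term := (injOn_union_iff (disjoint_of_disjoint_image h)).2
    ⟨hS.2, hT.2, by rwa [← hS.3, ← hT.3]⟩
  image_eq := by rw [Finset.image_union, Finset.image_union, hS.3, hT.3]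

theorem Permutes.sdiff {S T : Finset G.Dart} (hS : G.Permutes S) (hT : G.Permutes T)
    (hTS : T ⊆ S) : G.Permutes (S \ T) := by
  have hsub : ((S \ T : Finset G.Dart) : Set G.Dart) ⊆ S := by
    simp
  refine ⟨hS.1.mono hsub, hS.2.mono hsub, ?_⟩
  rw [Finset.image_sdiff_of_injOn hS.1 hTS, Finset.image_sdiff_of_injOn hS.2 hTS, hS.3, hT.3]

/-- The remaining set `T` has no origin at either end of the edge, so the pair acts as an
independent transposition. This is the source of the sign `-1` of each matching edge. -/
theorem move_insert_pair {T : Finset G.Dart} {d : G.Dart}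
    (h : Set.InjOn G.org ↑(insert d (insert (G.rev d) T))) (hd : d ∉ T) (hd' : G.rev d ∉ T) :
    G.move (insert d (insert (G.rev d) T)) = G.move T ∘ Equiv.swap (G.org d) (G.term d) := by
  have hT : Set.InjOn G.org T := h.mono fun x hx => by simp [Finset.mem_coe.1 hx]
  have h1 : G.org d ∉ T.image G.org := by
    intro hm
    obtain ⟨x, hx, hxd⟩ := Finset.mem_image.1 hm
    exact hd (h (by simp [hx]) (by simp) hxd ▸ hx)
  have h2 : G.term d ∉ T.image G.org := by
    intro hm
    obtain ⟨x, hx, hxd⟩ := Finset.mem_image.1 hm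
    rw [← G.org_rev] at hxd
    exact hd' (h (by simp [hx]) (by simp) hxd ▸ hx)
  funext u
  rw [Function.comp_apply]
  by_cases hu1 : u = G.org d
  · subst hu1
    rw [Equiv.swap_apply_left, move_org h (by simp), move_of_notMem h2]
  by_cases hu2 : u = G.term d
  · subst hu2
    rw [Equiv.swap_apply_right, move_of_notMem h1, ← G.org_rev, move_org h (by simp), G.term_rev]
  rw [Equiv.swap_apply_of_ne_of_ne hu1 hu2]
  by_cases hu : u ∈ T.image G.org
  · obtain ⟨x, hx, rfl⟩ := Finset.mem_image.1 hu
    rw [move_org h (by simp [hx]), move_org hT hx]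
  · rw [move_of_notMem hu, move_of_notMem]
    simp only [Finset.image_insert, Finset.mem_insert, G.org_rev, not_or]
    exact ⟨hu1, hu2, hu⟩

theorem org_ne_term_of_injOn {S : Finset G.Dart} (h : Set.InjOn G.org S) {d : G.Dart}
    (hd : d ∈ S) (hd' : G.rev d ∈ S) : G.org d ≠ G.term d := by
  intro hdd
  rw [← G.org_rev] at hdd
  exact G.rev_ne d (h hd hd' hdd).symm

/-- The edges both of whose orientations belong to `S`. -/
noncomputable def doubledEdges [Fintype E] (S : Finset G.Dart) : Finset E :=
  Finset.univ.filter fun e => (e, true) ∈ S ∧ (e, false) ∈ S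

theorem mem_bothDarts_doubledEdges [Fintype E] {S : Finset G.Dart} {d : G.Dart} :
    d ∈ G.bothDarts (doubledEdges S) ↔ d ∈ S ∧ G.rev d ∈ S := by
  obtain ⟨e, _ | _⟩ := d <;> simp [doubledEdges, rev, and_comm]

theorem Permutes.oriented_sdiff [Fintype E] {S : Finset G.Dart} (hS : G.Permutes S) :
    G.Oriented (S \ G.bothDarts (doubledEdges S)) := by
  have hsub : G.bothDarts (doubledEdges S) ⊆ S := fun d hd =>
    (mem_bothDarts_doubledEdges.1 hd).1
  refine ⟨hS.sdiff (Permutes.bothDarts (hS.1.mono hsub)) hsub, fun d hd hd' => ?_⟩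
  rw [Finset.mem_sdiff, mem_bothDarts_doubledEdges] at hd hd'
  exact hd.2 ⟨hd.1, hd'.1⟩

theorem selfMapSign_move_union_bothDarts [Fintype V] {O : Finset G.Dart} {M : Finset E}
    (h : Set.InjOn G.org ↑(O ∪ G.bothDarts M)) (hOM : Disjoint O (G.bothDarts M)) :
    selfMapSign (G.move (O ∪ G.bothDarts M)) = (-1) ^ M.card * selfMapSign (G.move O) := by
  induction M using Finset.induction with
  | empty => simp
  | insert e M he ih =>
    have hrev : ((e, false) : G.Dart) = G.rev (e, true) := rfl
    have heq : O ∪ G.bothDarts (insert e M) =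
        insert (e, true) (insert (G.rev (e, true)) (O ∪ G.bothDarts M)) := by
      rw [bothDarts_insert, Finset.union_insert, Finset.union_insert, hrev]
    have hM : ∀ s, ((e, s) : G.Dart) ∉ O ∪ G.bothDarts M := by
      intro s hs
      rcases Finset.mem_union.1 hs with hs | hs
      · exact Finset.disjoint_left.1 hOM hs (by simp)
      · simp [he] at hs
    rw [heq] at h ⊢
    rw [move_insert_pair h (hM _) (hM _), selfMapSign_comp, selfMapSign_perm,
      Equiv.Perm.sign_swap (org_ne_term_of_injOn h (by simp) (by simp)),
      ih (h.mono fun x hx => by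
        rw [Finset.mem_coe] at hx ⊢
        exact Finset.mem_insert_of_mem (Finset.mem_insert_of_mem hx))
        (hOM.mono_right (Finset.product_subset_product_left (Finset.subset_insert e M))),
      Finset.card_insert_of_notMem he, pow_succ]
    simp

theorem prod_neg_bothDarts {R : Type*} [CommRing R] (a : G.Dart → R) (M : Finset E) :
    ∏ d ∈ G.bothDarts M, -a d = ∏ d ∈ G.bothDarts M, a d := by
  rw [Finset.prod_product, Finset.prod_product]
  simp

variable [Fintype V] [Fintype E] {R : Type*} [CommRing R]

/-- The sum over the matchings that avoid the vertices in `W`, with `c` as weights of the vertices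
that belong neither to the matching nor to `W`. -/
noncomputable def matchingSum (a : G.Dart → R) (c : V → R) (W : Finset V) : R :=
  ∑ M : Finset E with Set.InjOn G.org (G.bothDarts M) ∧ Disjoint W ((G.bothDarts M).image G.org),
    (-1) ^ M.card * (∏ d ∈ G.bothDarts M, a d) *
      ∏ u ∈ Finset.univ \ (W ∪ (G.bothDarts M).image G.org), c u

/-- The determinant of a Schrödinger-type matrix as a sum over oriented degree-2 subgraphs. -/
theorem det_dartMatrix (a : G.Dart → R) (c : V → R) :
    (G.dartMatrix a c).det = ∑ O : Finset G.Dart with G.Oriented O,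
      (selfMapSign (G.move O) : R) * (∏ d ∈ O, -a d) * matchingSum a c (O.image G.org) := by
  rw [det_dartMatrix_eq_sum_permutes]
  simp only [matchingSum, Finset.mul_sum]
  rw [Finset.sum_sigma']
  -- `S` corresponds to the pair of its doubled edges and the rest. A loop, or a 2-cycle along two
  -- parallel edges, stays in the oriented part.
  refine Finset.sum_nbij' (fun S => ⟨S \ G.bothDarts (doubledEdges S), doubledEdges S⟩)
    (fun p => p.1 ∪ G.bothDarts p.2) ?_ ?_ ?_ ?_ ?_
  · intro S hS
    have hS := (Finset.mem_filter.1 hS).2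
    have hsub : G.bothDarts (doubledEdges S) ⊆ S := fun d hd =>
      (mem_bothDarts_doubledEdges.1 hd).1
    have hinj := hS.1
    rw [← Finset.sdiff_union_of_subset hsub, injOn_union_iff Finset.sdiff_disjoint] at hinj
    simp only [Finset.mem_sigma, Finset.mem_filter, Finset.mem_univ, true_and]
    exact ⟨hS.oriented_sdiff, hinj.2⟩
  · rintro ⟨O, M⟩ hp
    simp only [Finset.mem_sigma, Finset.mem_filter, Finset.mem_univ, true_and] at hp ⊢
    exact hp.1.toPermutes.union (Permutes.bothDarts hp.2.1) hp.2.2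
  · intro S hS
    have hsub : G.bothDarts (doubledEdges S) ⊆ S := fun d hd =>
      (mem_bothDarts_doubledEdges.1 hd).1
    exact Finset.sdiff_union_of_subset hsub
  · rintro ⟨O, M⟩ hp
    simp only [Finset.mem_sigma, Finset.mem_filter, Finset.mem_univ, true_and] at hp
    have hdis := disjoint_of_disjoint_image hp.2.2
    have hM : doubledEdges (O ∪ G.bothDarts M) = M := by
      ext e
      have h1 := hp.1.rev_notMem (e, true)
      have h2 : ((e, false) : G.Dart) = G.rev (e, true) := rfl
      by_cases he : e ∈ M
      · simp [doubledEdges, he]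
      · simp [doubledEdges, he]
        rwa [h2]
    simp only [hM]
    rw [Finset.union_sdiff_cancel_right hdis]
  · intro S hS
    have hS := (Finset.mem_filter.1 hS).2
    have hsub : G.bothDarts (doubledEdges S) ⊆ S := fun d hd =>
      (mem_bothDarts_doubledEdges.1 hd).1
    have hinj := hS.1
    have hun := Finset.sdiff_union_of_subset hsub
    rw [← hun] at hinj
    have hsign := selfMapSign_move_union_bothDarts hinj Finset.sdiff_disjoint
    rw [hun] at hsign
    simp only
    rw [hsign, ← Finset.image_union, hun, ← Finset.prod_sdiff hsub, prod_neg_bothDarts]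
    push_cast
    ring

end MultiGraph

/-! ### Degree-2 subgraphs and their orientations -/

/-- Two fixed-point-free involutions have a common 2-colouring. -/
theorem exists_common_coloring {X : Type*} (p q : Equiv.Perm X)
    (hp : ∀ x, p (p x) = x) (hq : ∀ x, q (q x) = x) (hp' : ∀ x, p x ≠ x) (hq' : ∀ x, q x ≠ x) :
    ∃ C : Set X, (∀ x, p x ∈ C ↔ x ∉ C) ∧ ∀ x, q x ∈ C ↔ x ∉ C := by
  let r : Equiv.Perm X := p * q
  have hpp : p * p = 1 := Equiv.ext hp
  have hqq : q * q = 1 := Equiv.ext hq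
  have hp_inv : p⁻¹ = p := inv_eq_of_mul_eq_one_left hpp
  have hq_inv : q⁻¹ = q := inv_eq_of_mul_eq_one_left hqq
  have hconj : p * r * p⁻¹ = r⁻¹ := by
    simp only [r]
    rw [mul_inv_rev, hq_inv, hp_inv, ← mul_assoc, hpp, one_mul]
  have hpr : ∀ (k : ℤ) x, p ((r ^ k) x) = (r ^ (-k)) (p x) := by
    intro k x
    have h : p * r ^ k = r ^ (-k) * p := by
      rw [zpow_neg, ← inv_zpow, ← hconj, conj_zpow, inv_mul_cancel_right]
    exact congrArg (fun σ : Equiv.Perm X => σ x) h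
  -- Suppose `p x = r ^ n x`. Since `p` inverts `r`, `r ^ j x` is fixed by `p` if `n = 2j` and by
  -- `q` if `n = 2j + 1`.
  have hnot : ∀ x, ¬ r.SameCycle x (p x) := by
    rintro x ⟨n, hn⟩
    obtain ⟨j, rfl | rfl⟩ := Int.even_or_odd' n
    · refine hp' ((r ^ j) x) ?_
      rw [hpr, ← hn, ← Equiv.Perm.mul_apply, ← zpow_add]
      congr 2
      ring
    · refine hq' ((r ^ j) x) (p.injective ?_)
      rw [hpr, ← hn, ← Equiv.Perm.mul_apply (r ^ (-j)), ← zpow_add]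
      change r ((r ^ j) x) = _
      rw [← Equiv.Perm.mul_apply, ← zpow_one_add]
      congr 2
      ring
  let cl : X → Quotient (Equiv.Perm.SameCycle.setoid r) := Quotient.mk _
  have hne : ∀ x, cl x ≠ cl (p x) := fun x h => hnot x (Quotient.exact h)
  have hq1 : ∀ x, cl (q x) = cl (p x) := fun x => Quotient.sound ⟨1, by simp [r, hq]⟩
  have hq2 : ∀ x, cl (p (q x)) = cl x := fun x => (Quotient.sound ⟨1, by simp [r]⟩ : cl x = _).symm
  have hasymm : ∀ a b : Quotient (Equiv.Perm.SameCycle.setoid r), a ≠ b →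
      (WellOrderingRel b a ↔ ¬ WellOrderingRel a b) := by
    intro a b hab
    constructor
    · intro h h'
      exact asymm_of WellOrderingRel h h'
    · intro h
      exact ((trichotomous_of WellOrderingRel a b).resolve_left h).resolve_left hab
  -- Both involutions exchange the cycle of `x` with the distinct cycle of `p x`; an arbitrary
  -- well-order selects one cycle of each such pair.
  refine ⟨{x | WellOrderingRel (cl x) (cl (p x))}, fun x => ?_, fun x => ?_⟩
  · simp only [Set.mem_ofPred_eq, hp]
    exact hasymm _ _ (hne x)
  · simp only [Set.mem_ofPred_eq, hq1, hq2]
    exact hasymm _ _ (hne x)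

namespace MultiGraph

open scoped Classical

variable {V E : Type*} {G : MultiGraph V E}

theorem Subgraph.rev_mem_darts {S : G.Subgraph} {d : G.Dart} : G.rev d ∈ S.darts ↔ d ∈ S.darts :=
  G.rev_mem_bothDarts

theorem Subgraph.org_mem {S : G.Subgraph} {d : G.Dart} (hd : d ∈ S.darts) : G.org d ∈ S.verts := by
  obtain ⟨e, _ | _⟩ := d
  · exact S.tgt_mem e (Finset.mem_product.1 hd).1
  · exact S.src_mem e (Finset.mem_product.1 hd).1

theorem Subgraph.term_mem {S : G.Subgraph} {d : G.Dart} (hd : d ∈ S.darts) :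
    G.term d ∈ S.verts := by
  rw [← G.org_rev]
  exact S.org_mem (S.rev_mem_darts.2 hd)

/-- Every degree-2 subgraph can be oriented. -/
theorem Subgraph.exists_oriented {γ : G.Subgraph} (hγ : γ.IsDegree 2) :
    ∃ O : Finset G.Dart, G.Oriented O ∧ O.image G.org = γ.verts := by
  -- With `q` the passage to the other directed edge at the same origin and `p` the reversal, a
  -- colour class of a common 2-colouring takes one direction of each edge and one outgoing directed
  -- edge at each vertex.
  have hother : ∀ d : γ.darts, ∃ d' : γ.darts, d' ≠ d ∧ G.org d' = G.org d ∧
      ∀ x : γ.darts, G.org x = G.org d → x = d ∨ x = d' := by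
    rintro ⟨d, hd⟩
    have hcard := hγ _ (γ.org_mem hd)
    rw [Subgraph.degree] at hcard
    have hmem : d ∈ γ.darts.filter fun x => G.org x = G.org d := by simp [hd]
    have key : ∀ a b : G.Dart, a ≠ b → (γ.darts.filter fun x => G.org x = G.org a) = {a, b} →
        ∃ d' : γ.darts, d'.1 ≠ a ∧ G.org d' = G.org a ∧
          ∀ x : γ.darts, G.org x = G.org a → x.1 = a ∨ x.1 = d' := by
      intro a b hab heq
      have hb : b ∈ γ.darts.filter fun x => G.org x = G.org a := by simp [heq]
      rw [Finset.mem_filter] at hb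
      refine ⟨⟨b, hb.1⟩, hab.symm, hb.2, fun x hx => ?_⟩
      have : x.1 ∈ γ.darts.filter fun x => G.org x = G.org a := Finset.mem_filter.2 ⟨x.2, hx⟩
      simpa [heq] using this
    simp only [ne_eq, Subtype.ext_iff]
    obtain ⟨a, b, hab, heq⟩ := Finset.card_eq_two.1 hcard
    have hd' : d = a ∨ d = b := by simpa [heq] using hmem
    rcases hd' with rfl | rfl
    · exact key d b hab heq
    · exact key d a hab.symm (heq.trans (Finset.pair_comm a d))
  choose q hq1 hq2 hq3 using hother
  have hqq : ∀ x, q (q x) = x := fun x =>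
    ((hq3 (q x) x (hq2 x).symm).resolve_left (hq1 x).symm).symm
  let p : γ.darts → γ.darts := fun d => ⟨G.rev d, γ.rev_mem_darts.2 d.2⟩
  have hpp : ∀ x, p (p x) = x := fun x => Subtype.ext (G.rev_rev x)
  obtain ⟨C, hC1, hC2⟩ := exists_common_coloring (Function.Involutive.toPerm p hpp)
    (Function.Involutive.toPerm q hqq) hpp hqq
    (fun x h => G.rev_ne x (congrArg Subtype.val h)) hq1
  replace hC1 : ∀ x, p x ∈ C ↔ x ∉ C := hC1
  replace hC2 : ∀ x, q x ∈ C ↔ x ∉ C := hC2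
  have hvert : ∀ v ∈ γ.verts, ∃ x : γ.darts, G.org x = v := by
    intro v hv
    have hcard := hγ v hv
    rw [Subgraph.degree] at hcard
    obtain ⟨d, hd⟩ := Finset.card_pos.1 (by omega :
      0 < (γ.darts.filter fun d => G.org d = v).card)
    rw [Finset.mem_filter] at hd
    exact ⟨⟨d, hd.1⟩, hd.2⟩
  have hvertC : ∀ v ∈ γ.verts, ∃ x : γ.darts, x ∈ C ∧ G.org x = v := by
    intro v hv
    obtain ⟨x, rfl⟩ := hvert v hv
    by_cases hx : x ∈ C
    · exact ⟨x, hx, rfl⟩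
    · exact ⟨q x, (hC2 x).2 hx, hq2 x⟩
  let O : Finset G.Dart := γ.darts.attach.filter (· ∈ C) |>.image Subtype.val
  have hO : ∀ d, d ∈ O ↔ ∃ x : γ.darts, x ∈ C ∧ x.1 = d := by
    intro d
    simp [O]
  have horg : O.image G.org = γ.verts := by
    ext v
    simp only [Finset.mem_image, hO]
    constructor
    · rintro ⟨_, ⟨x, _, rfl⟩, rfl⟩
      exact γ.org_mem x.2
    · intro hv
      obtain ⟨x, hx, rfl⟩ := hvertC v hv
      exact ⟨x, ⟨x, hx, rfl⟩, rfl⟩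
  have hterm : O.image G.term = γ.verts := by
    ext v
    simp only [Finset.mem_image, hO]
    constructor
    · rintro ⟨_, ⟨x, _, rfl⟩, rfl⟩
      exact γ.term_mem x.2
    · intro hv
      obtain ⟨x, hx, rfl⟩ := hvertC v hv
      -- The outgoing `q x` is not in `C`, so its reversal is, and it ends at the vertex.
      refine ⟨p (q x), ⟨p (q x), (hC1 _).2 fun h => (hC2 x).1 h hx, rfl⟩, ?_⟩
      change G.term (G.rev (q x)) = _
      rw [G.term_rev, hq2]
  refine ⟨O, ⟨⟨?_, ?_, horg.trans hterm.symm⟩, ?_⟩, horg⟩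
  · intro d hd d' hd' h
    obtain ⟨x, hx, rfl⟩ := (hO d).1 hd
    obtain ⟨y, hy, rfl⟩ := (hO d').1 hd'
    rcases hq3 x y h.symm with rfl | rfl
    · rfl
    · exact absurd hx ((hC2 x).1 hy)
  · intro d hd d' hd' h
    obtain ⟨x, hx, rfl⟩ := (hO d).1 hd
    obtain ⟨y, hy, rfl⟩ := (hO d').1 hd'
    rcases hq3 (p x) (p y) (by simpa [p] using h.symm) with h' | h'
    · rw [← hpp x, ← h', hpp]
    · have h1 : p x ∉ C := fun hpx => (hC1 x).1 hpx hx
      have h2 : p y ∈ C := h' ▸ (hC2 _).2 h1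
      exact absurd hy ((hC1 y).1 h2)
  · intro d hd hd'
    obtain ⟨x, hx, rfl⟩ := (hO d).1 hd
    obtain ⟨y, hy, hyx⟩ := (hO _).1 hd'
    have : y = p x := Subtype.ext hyx
    exact (hC1 x).1 (this ▸ hy) hx

/-- The subgraph underlying an oriented degree-2 subgraph. -/
noncomputable def Oriented.subgraph {O : Finset G.Dart} (hO : G.Oriented O) : G.Subgraph where
  verts := O.image G.org
  edges := O.image Prod.fst
  src_mem e he := by
    obtain ⟨⟨e, _ | _⟩, hd, rfl⟩ := Finset.mem_image.1 he
    · rw [hO.image_eq]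
      exact Finset.mem_image.2 ⟨_, hd, rfl⟩
    · exact Finset.mem_image.2 ⟨_, hd, rfl⟩
  tgt_mem e he := by
    obtain ⟨⟨e, _ | _⟩, hd, rfl⟩ := Finset.mem_image.1 he
    · exact Finset.mem_image.2 ⟨_, hd, rfl⟩
    · rw [hO.image_eq]
      exact Finset.mem_image.2 ⟨_, hd, rfl⟩

/-- At each vertex exactly one element of `O` leaves and one enters; the first and the reversal of
the second are distinct because `O` contains no reversed pair. -/
theorem Oriented.isDegree_subgraph {O : Finset G.Dart} (hO : G.Oriented O) :
    hO.subgraph.IsDegree 2 := by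
  intro v hv
  have hv1 : v ∈ O.image G.org := hv
  have hv2 := hv1
  rw [hO.image_eq] at hv2
  obtain ⟨d, hd, rfl⟩ := Finset.mem_image.1 hv1
  obtain ⟨d', hd', hdd⟩ := Finset.mem_image.1 hv2
  have hmem : ∀ x : G.Dart, x ∈ hO.subgraph.darts ↔ x ∈ O ∨ G.rev x ∈ O := by
    rintro ⟨e, _ | _⟩ <;> simp [Subgraph.darts, Oriented.subgraph, rev, or_comm]
  have : (hO.subgraph.darts.filter fun x => G.org x = G.org d) = {d, G.rev d'} := by
    ext x
    simp only [Finset.mem_filter, hmem, Finset.mem_insert, Finset.mem_singleton]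
    constructor
    · rintro ⟨hx | hx, h⟩
      · exact Or.inl (hO.injOn_org hx hd h)
      · right
        rw [← hO.injOn_term hx hd' (by rw [G.term_rev, h, hdd]), G.rev_rev]
    · rintro (rfl | rfl)
      · exact ⟨Or.inl hd, rfl⟩
      · exact ⟨Or.inr (by rwa [G.rev_rev]), by rw [G.org_rev, hdd]⟩
  rw [Subgraph.degree, this, Finset.card_pair]
  rintro rfl
  exact hO.rev_notMem _ hd' hd

/-- A degree-2 subgraph has several orientations, but conditions that depend on its vertex set alone
do not see the difference. -/
theorem forall_isDegree_two_iff (P : Finset V → Prop) :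
    (∀ γ : G.Subgraph, γ.IsDegree 2 → P γ.verts) ↔
      ∀ O : Finset G.Dart, G.Oriented O → P (O.image G.org) := by
  constructor
  · intro h O hO
    exact h hO.subgraph hO.isDegree_subgraph
  · intro h γ hγ
    obtain ⟨O, hO, hv⟩ := Subgraph.exists_oriented hγ
    exact hv ▸ h O hO

/-! ### Matching polynomials as sums over sets of edges -/

theorem Subgraph.IsMatching.injOn_org {M : G.Subgraph} (hM : M.IsMatching) :
    Set.InjOn G.org (G.bothDarts M.edges) := by
  intro d hd d' hd' h
  have h1 := hM _ (M.org_mem hd)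
  rw [Subgraph.degree] at h1
  exact Finset.card_le_one.1 h1.le d (Finset.mem_filter.2 ⟨hd, rfl⟩) d'
    (Finset.mem_filter.2 ⟨hd', h.symm⟩)

theorem Subgraph.IsMatching.verts_eq {M : G.Subgraph} (hM : M.IsMatching) :
    M.verts = (G.bothDarts M.edges).image G.org := by
  ext v
  constructor
  · intro hv
    have h1 := hM v hv
    rw [Subgraph.degree] at h1
    obtain ⟨d, hd⟩ := Finset.card_pos.1 (by omega :
      0 < (M.darts.filter fun d => G.org d = v).card)
    rw [Finset.mem_filter] at hd
    exact Finset.mem_image.2 ⟨d, hd⟩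
  · intro hv
    obtain ⟨d, hd, rfl⟩ := Finset.mem_image.1 hv
    exact M.org_mem hd

/-- The subgraph with the given edges and their endpoints. -/
noncomputable def Subgraph.ofEdges (G : MultiGraph V E) (M : Finset E) : G.Subgraph where
  verts := (G.bothDarts M).image G.org
  edges := M
  src_mem e he := Finset.mem_image.2 ⟨(e, true), by simp [he], rfl⟩
  tgt_mem e he := Finset.mem_image.2 ⟨(e, false), by simp [he], rfl⟩

theorem Subgraph.isMatching_ofEdges {M : Finset E} (hM : Set.InjOn G.org (G.bothDarts M)) :
    (Subgraph.ofEdges G M).IsMatching := by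
  intro v hv
  obtain ⟨d, hd, rfl⟩ := Finset.mem_image.1 hv
  rw [Subgraph.degree, Finset.card_eq_one]
  refine ⟨d, ?_⟩
  ext x
  rw [Finset.mem_filter, Finset.mem_singleton]
  constructor
  · rintro ⟨hx, h⟩
    exact hM hx hd h
  · rintro rfl
    exact ⟨hd, rfl⟩

/-- A matching has no isolated vertices, so its edges determine it and `|V_M| / 2` is the number of
edges. -/
theorem eval_matchingPolynomial [Fintype V] [Fintype E] (H : SchrodingerOperator G) (z : ℂ) :
    H.matchingPolynomial.eval z = matchingSum H.weight (fun u => z - H.potential u) ∅ := by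
  rw [SchrodingerOperator.matchingPolynomial, matchingSum, Polynomial.eval_finsetSum]
  refine Finset.sum_nbij' Subgraph.edges (Subgraph.ofEdges G) ?_ ?_ ?_ ?_ ?_
  · intro M hM
    simpa using (Finset.mem_filter.1 hM).2.injOn_org
  · intro M hM
    simpa using Subgraph.isMatching_ofEdges (Finset.mem_filter.1 hM).2.1
  · intro M hM
    have h := (Finset.mem_filter.1 hM).2.verts_eq
    obtain ⟨vs, es, _, _⟩ := M
    simp only [Subgraph.ofEdges, Subgraph.mk.injEq, and_true]
    exact h.symm
  · intro M _
    rfl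
  · intro M hM
    have hM := (Finset.mem_filter.1 hM).2
    have hcard : M.verts.card / 2 = M.edges.card := by
      rw [hM.verts_eq, Finset.card_image_of_injOn hM.injOn_org, Finset.card_product]
      simp
    rw [hcard, Finset.empty_union, ← hM.verts_eq]
    simp only [Polynomial.eval_mul, Polynomial.eval_pow, Polynomial.eval_neg, Polynomial.eval_one,
      Polynomial.eval_C, Polynomial.eval_prod, Polynomial.eval_sub, Polynomial.eval_X,
      Subgraph.darts]

theorem matchingSum_delete [Fintype V] [Fintype E] (γ : G.Subgraph)
    [Fintype {v : V // v ∉ γ.verts}] [Fintype {e : E // G.src e ∉ γ.verts ∧ G.tgt e ∉ γ.verts}]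
    {R : Type*} [CommRing R] (a : G.Dart → R) (c : V → R) :
    matchingSum (G := G.delete γ) (fun d => a (d.1.1, d.2)) (fun u => c u.1) ∅ =
      matchingSum a c γ.verts := by
  let f : (G.delete γ).Dart → G.Dart := fun d => (d.1.1, d.2)
  have hf : Function.Injective f := by
    rintro ⟨⟨e, _⟩, s⟩ ⟨⟨e', _⟩, s'⟩ h
    simpa [f] using h
  have hforg : ∀ d, G.org (f d) = ((G.delete γ).org d).1 := by
    rintro ⟨e, _ | _⟩ <;> rfl
  have hdarts : ∀ M : Finset {e : E // G.src e ∉ γ.verts ∧ G.tgt e ∉ γ.verts},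
      G.bothDarts (M.map (Function.Embedding.subtype _)) =
        ((G.delete γ).bothDarts M).map ⟨f, hf⟩ := by
    intro M
    ext ⟨e, s⟩
    simp [f]
  have himage : ∀ M : Finset {e : E // G.src e ∉ γ.verts ∧ G.tgt e ∉ γ.verts},
      (G.bothDarts (M.map (Function.Embedding.subtype _))).image G.org =
        (((G.delete γ).bothDarts M).image (G.delete γ).org).image Subtype.val := by
    intro M
    rw [hdarts, Finset.map_eq_image, Finset.image_image, Finset.image_image]
    exact Finset.image_congr fun d _ => hforg d
  rw [matchingSum, matchingSum]
  refine Finset.sum_nbij' (fun M => M.map (Function.Embedding.subtype _))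
    (fun M => M.subtype fun e => G.src e ∉ γ.verts ∧ G.tgt e ∉ γ.verts) ?_ ?_ ?_ ?_ ?_
  · intro M hM
    simp only [Finset.mem_filter] at hM
    replace hM := hM.2.1
    refine Finset.mem_filter.2 ⟨Finset.mem_univ _, ?_, ?_⟩
    · rw [hdarts, Finset.coe_map]
      rintro _ ⟨d, hd, rfl⟩ _ ⟨d', hd', rfl⟩ h
      simp only [Function.Embedding.coeFn_mk, hforg] at h ⊢
      rw [hM hd hd' (Subtype.ext h)]
    · rw [himage, Finset.disjoint_right]
      intro v hv
      obtain ⟨v, _, rfl⟩ := Finset.mem_image.1 hv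
      exact v.2
  · intro M hM
    have hM := (Finset.mem_filter.1 hM).2.1
    simp only [Finset.mem_filter]
    refine ⟨Finset.mem_univ _, ?_, Finset.disjoint_empty_left _⟩
    intro d hd d' hd' h
    refine hf (hM ?_ ?_ ?_)
    · simpa [f] using hd
    · simpa [f] using hd'
    · rw [hforg, hforg, h]
  · intro M _
    ext e
    simpa using fun _ => e.2
  · intro M hM
    have hM := (Finset.mem_filter.1 hM).2.2
    refine (Finset.subtype_map _).trans (Finset.filter_true_of_mem fun e he => ?_)
    rw [Finset.disjoint_right] at hM
    exact ⟨hM (Finset.mem_image.2 ⟨(e, true), by simp [he], rfl⟩),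
      hM (Finset.mem_image.2 ⟨(e, false), by simp [he], rfl⟩)⟩
  · intro M _
    have hcompl : Finset.univ \ (γ.verts ∪
        (G.bothDarts (M.map (Function.Embedding.subtype _))).image G.org) =
        (Finset.univ \ (∅ ∪ ((G.delete γ).bothDarts M).image (G.delete γ).org)).map
          (Function.Embedding.subtype _) := by
      rw [himage]
      ext v
      simp only [Finset.mem_sdiff, Finset.mem_univ, true_and, Finset.mem_union, not_or,
        Finset.empty_union, Finset.mem_map, Function.Embedding.coe_subtype]
      constructor
      · rintro ⟨hv, hv'⟩
        exact ⟨⟨v, hv⟩, fun h => hv' (Finset.mem_image_of_mem _ h), rfl⟩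
      · rintro ⟨u, hu, rfl⟩
        refine ⟨u.2, fun h => hu ?_⟩
        obtain ⟨w, hw, hwu⟩ := Finset.mem_image.1 h
        rwa [← Subtype.ext hwu]
    rw [hcompl, Finset.prod_map, Finset.card_map, hdarts, Finset.prod_map]
    congr! 1
    refine Finset.prod_congr ?_ fun _ _ => rfl
    congr!

theorem eval_matchingPolynomialDelete [Fintype V] [Fintype E] (H : SchrodingerOperator G)
    (γ : G.Subgraph) (z : ℂ) : (H.matchingPolynomialDelete γ).eval z =
      matchingSum H.weight (fun u => z - H.potential u) γ.verts := by
  rw [SchrodingerOperator.matchingPolynomialDelete, eval_matchingPolynomial,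
    ← matchingSum_delete]
  rfl

end MultiGraph

/-! ### Deleting vertices by truncating weights -/

namespace MultiGraph

open scoped Classical

variable {V E : Type*} {G : MultiGraph V E}

theorem Oriented.union {O O' : Finset G.Dart} (hO : G.Oriented O) (hO' : G.Oriented O')
    (h : Disjoint (O.image G.org) (O'.image G.org)) : G.Oriented (O ∪ O') := by
  refine ⟨hO.toPermutes.union hO'.toPermutes h, fun d hd hd' => ?_⟩
  have key : ∀ {P Q : Finset G.Dart}, G.Oriented P →
      Disjoint (P.image G.org) (Q.image G.org) → ∀ d ∈ P, G.rev d ∉ Q := by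
    intro P Q hP hPQ d hd hdQ
    have h1 : G.term d ∈ P.image G.org := by
      rw [hP.image_eq]
      exact Finset.mem_image_of_mem _ hd
    refine Finset.disjoint_left.1 hPQ h1 ?_
    rw [← G.org_rev]
    exact Finset.mem_image_of_mem _ hdQ
  rcases Finset.mem_union.1 hd with hd | hd <;> rcases Finset.mem_union.1 hd' with hd' | hd'
  · exact hO.rev_notMem d hd hd'
  · exact key hO h d hd hd'
  · exact key hO' h.symm d hd hd'
  · exact hO'.rev_notMem d hd hd'

theorem oriented_empty : G.Oriented ∅ :=
  ⟨⟨by simp, by simp, by simp⟩, by simp⟩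

theorem Oriented.term_mem_image {O : Finset G.Dart} (hO : G.Oriented O) {d : G.Dart} (hd : d ∈ O) :
    G.term d ∈ O.image G.org := by
  rw [hO.image_eq]
  exact Finset.mem_image_of_mem _ hd

section Truncation

variable {R : Type*} [CommRing R]

/-- The weights of the directed edges outside `W`, and zero on the others. -/
noncomputable def truncDart (a : G.Dart → R) (W : Finset V) (d : G.Dart) : R :=
  if G.org d ∉ W ∧ G.term d ∉ W then a d else 0

/-- The vertex weights outside `W`, and one on `W`. -/
noncomputable def truncVert (c : V → R) (W : Finset V) (u : V) : R :=
  if u ∈ W then 1 else c u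

variable [Fintype V] [Fintype E]

/-- A matching that meets `W` contains a directed edge of weight zero, and an uncovered vertex of
`W` contributes a factor one. Truncation thus deletes `W` while keeping the vertex type `V`. -/
theorem matchingSum_trunc (a : G.Dart → R) (c : V → R) {W X : Finset V} :
    matchingSum (truncDart a W) (truncVert c W) X = matchingSum a c (W ∪ X) := by
  rw [matchingSum, matchingSum]
  symm
  refine Finset.sum_subset_zero_on_sdiff ?_ ?_ ?_
  · intro M hM
    simp only [Finset.mem_filter, Finset.mem_univ, true_and, Finset.disjoint_union_left] at hM ⊢
    exact ⟨hM.1, hM.2.2⟩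
  · intro M hM
    simp only [Finset.mem_sdiff, Finset.mem_filter, Finset.mem_univ, true_and,
      Finset.disjoint_union_left, not_and] at hM
    have h1 : ¬ Disjoint W ((G.bothDarts M).image G.org) := fun hW => hM.2 hM.1.1 hW hM.1.2
    obtain ⟨v, hv, hv'⟩ := Finset.not_disjoint_iff.1 h1
    obtain ⟨d, hd, rfl⟩ := Finset.mem_image.1 hv'
    rw [Finset.prod_eq_zero hd]
    · simp
    · simp [truncDart, hv]
  · intro M hM
    simp only [Finset.mem_filter, Finset.mem_univ, true_and, Finset.disjoint_union_left] at hM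
    have hW := Finset.disjoint_right.1 hM.2.1
    congr 1
    · congr 1
      refine Finset.prod_congr rfl fun d hd => ?_
      have hterm : G.term d ∉ W := by
        rw [← G.org_rev]
        exact hW (Finset.mem_image_of_mem _ (G.rev_mem_bothDarts.2 hd))
      exact (if_pos ⟨hW (Finset.mem_image_of_mem _ hd), hterm⟩).symm
    · symm
      rw [← Finset.prod_subset (s₁ := Finset.univ \ (W ∪ X ∪ (G.bothDarts M).image G.org))]
      · refine Finset.prod_congr rfl fun u hu => ?_
        simp only [Finset.mem_sdiff, Finset.mem_union, not_or] at hu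
        rw [truncVert, if_neg hu.2.1.1]
      · intro u hu
        simp only [Finset.mem_sdiff, Finset.mem_union, not_or] at hu ⊢
        exact ⟨hu.1, hu.2.1.2, hu.2.2⟩
      · intro u hu hu'
        simp only [Finset.mem_sdiff, Finset.mem_union, not_or, Finset.mem_univ, true_and] at hu hu'
        rw [truncVert, if_pos]
        by_contra hW
        exact hu' ⟨⟨hW, hu.1⟩, hu.2⟩

theorem det_dartMatrix_trunc (a : G.Dart → R) (c : V → R) (W : Finset V) :
    (G.dartMatrix (truncDart a W) (truncVert c W)).det =
      ∑ O : Finset G.Dart with G.Oriented O ∧ Disjoint W (O.image G.org),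
        (selfMapSign (G.move O) : R) * (∏ d ∈ O, -a d) * matchingSum a c (W ∪ O.image G.org) := by
  rw [det_dartMatrix]
  symm
  refine Finset.sum_subset_zero_on_sdiff ?_ ?_ ?_
  · intro O hO
    simp only [Finset.mem_filter, Finset.mem_univ, true_and] at hO ⊢
    exact hO.1
  · intro O hO
    simp only [Finset.mem_sdiff, Finset.mem_filter, Finset.mem_univ, true_and, not_and] at hO
    obtain ⟨v, hv, hv'⟩ := Finset.not_disjoint_iff.1 (hO.2 hO.1)
    obtain ⟨d, hd, rfl⟩ := Finset.mem_image.1 hv'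
    rw [Finset.prod_eq_zero hd]
    · simp
    · simp [truncDart, hv]
  · intro O hO
    simp only [Finset.mem_filter, Finset.mem_univ, true_and] at hO
    rw [matchingSum_trunc]
    congr 2
    refine Finset.prod_congr rfl fun d hd => ?_
    have hW := Finset.disjoint_right.1 hO.2
    rw [truncDart, if_pos ⟨hW (Finset.mem_image_of_mem _ hd), hW (hO.1.term_mem_image hd)⟩]

theorem forall_matchingSum_eq_zero_iff_forall_det [CharZero R] [IsDomain R] (a : G.Dart → R)
    (c : V → R) :
    (∀ O : Finset G.Dart, G.Oriented O → matchingSum a c (O.image G.org) = 0) ↔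
      ∀ O : Finset G.Dart, G.Oriented O → (G.dartMatrix (truncDart a (O.image G.org))
        (truncVert c (O.image G.org))).det = 0 := by
  constructor
  · intro h O hO
    rw [det_dartMatrix_trunc]
    refine Finset.sum_eq_zero fun O' hO' => ?_
    rw [Finset.mem_filter] at hO'
    rw [← Finset.image_union, h _ (hO.union hO'.2.1 hO'.2.2), mul_zero]
  · intro h
    by_contra! hne
    -- For a largest `O` with non-zero matching sum, every term with non-empty `O'` involves the
    -- larger `O ∪ O'` and vanishes. Only `O' = ∅` is left, which contradicts the vanishing of the
    -- determinant.
    obtain ⟨O, hO, hOmax⟩ := Finset.exists_max_image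
      (Finset.univ.filter fun O : Finset G.Dart =>
        G.Oriented O ∧ matchingSum a c (O.image G.org) ≠ 0) Finset.card (by
          obtain ⟨O, hO⟩ := hne
          exact ⟨O, by simpa using hO⟩)
    simp only [Finset.mem_filter, Finset.mem_univ, true_and] at hO hOmax
    have hdet := h O hO.1
    rw [det_dartMatrix_trunc, Finset.sum_eq_single ∅] at hdet
    · have hsign : (selfMapSign (G.move ∅) : R) ≠ 0 :=
        Int.cast_ne_zero.2 (selfMapSign_ne_zero oriented_empty.injective_move)
      exact mul_ne_zero hsign hO.2 (by simpa using hdet)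
    · intro O' hO' hne'
      simp only [Finset.mem_filter, Finset.mem_univ, true_and] at hO'
      have hcard : (O ∪ O').card = O.card + O'.card :=
        Finset.card_union_of_disjoint (disjoint_of_disjoint_image hO'.2)
      have hpos : 0 < O'.card := Finset.card_pos.2 (Finset.nonempty_iff_ne_empty.2 hne')
      rw [← Finset.image_union]
      by_cases h0 : matchingSum a c ((O ∪ O').image G.org) = 0
      · rw [h0, mul_zero]
      · have := hOmax _ ⟨hO.1.union hO'.1 hO'.2, h0⟩
        omega
    · intro hn
      exact absurd (Finset.mem_filter.2 ⟨Finset.mem_univ _, oriented_empty, by simp⟩) hn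

theorem dartMatrix_mulVec (a : G.Dart → R) (c : V → R) (f : V → R) (u : V) :
    (G.dartMatrix a c).mulVec f u =
      c u * f u - ∑ d : G.Dart, if G.org d = u then a d * f (G.term d) else 0 := by
  simp only [Matrix.mulVec, dotProduct, dartMatrix, sub_mul, Finset.sum_sub_distrib, ite_mul,
    zero_mul, Finset.sum_ite_eq, Finset.mem_univ, if_true, Finset.sum_mul]
  congr 1
  rw [Finset.sum_comm]
  refine Finset.sum_congr rfl fun d _ => ?_
  by_cases h : G.org d = u <;> simp [h]

end Truncation

end MultiGraph

/-! ### Eigenvalues of the deleted graphs -/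

namespace SchrodingerOperator

open scoped Classical

open MultiGraph

variable {V E : Type*} {G : MultiGraph V E}

theorem op_apply [Fintype E] [DecidableEq V] (H : SchrodingerOperator G) (f : V → ℂ) (u : V) :
    H.op f u = (∑ d : G.Dart, if G.org d = u then H.weight d * f (G.term d) else 0) +
      H.potential u * f u := by
  rw [← Finset.sum_filter]
  have h : G.dartsFrom u = Finset.univ.filter fun d => G.org d = u := by
    ext d
    simp [dartsFrom]
  rw [← h]
  rfl

variable [Fintype V] [Fintype E]

/-- The diagonal of `z - H`, without the contribution of self-loops. -/
noncomputable def diag (H : SchrodingerOperator G) (z : ℂ) (u : V) : ℂ := z - H.potential u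

/-- The truncated matrix is block diagonal: the identity on `γ.verts` and λ minus the restricted
operator elsewhere. Square-summability is automatic on a finite set. -/
theorem hasL2Eigenvalue_delete_iff (H : SchrodingerOperator G) (γ : G.Subgraph) (lam : ℝ) :
    (H.delete γ).HasL2Eigenvalue lam ↔ (G.dartMatrix (truncDart H.weight γ.verts)
      (truncVert (H.diag lam) γ.verts)).det = 0 := by
  let ι : (G.delete γ).Dart → G.Dart := fun d => (d.1.1, d.2)
  have hι : Function.Injective ι := by
    rintro ⟨⟨e, _⟩, s⟩ ⟨⟨e', _⟩, s'⟩ h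
    simpa [ι] using h
  have hιorg : ∀ d, G.org (ι d) = ((G.delete γ).org d).1 := by
    rintro ⟨e, _ | _⟩ <;> rfl
  have hιterm : ∀ d, G.term (ι d) = ((G.delete γ).term d).1 := by
    rintro ⟨e, _ | _⟩ <;> rfl
  have hιrange : ∀ d : G.Dart, G.org d ∉ γ.verts → G.term d ∉ γ.verts → ∃ d', ι d' = d := by
    rintro ⟨e, _ | _⟩ h1 h2
    · exact ⟨(⟨e, h2, h1⟩, false), rfl⟩
    · exact ⟨(⟨e, h1, h2⟩, true), rfl⟩
  have hout : ∀ (f : V → ℂ), ∀ u ∈ γ.verts, (G.dartMatrix (truncDart H.weight γ.verts)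
      (truncVert (H.diag lam) γ.verts)).mulVec f u = f u := by
    intro f u hu
    rw [dartMatrix_mulVec, truncVert, if_pos hu, one_mul, sub_eq_self]
    refine Finset.sum_eq_zero fun d _ => ?_
    split_ifs with h
    · rw [truncDart, if_neg, zero_mul]
      rw [h]
      exact fun h' => h'.1 hu
    · rfl
  have hin : ∀ (f : V → ℂ) (u : {v // v ∉ γ.verts}), (G.dartMatrix (truncDart H.weight γ.verts)
      (truncVert (H.diag lam) γ.verts)).mulVec f u =
        lam * f u - (H.delete γ).op (fun v => f v) u := by
    intro f u
    rw [dartMatrix_mulVec, op_apply, truncVert, if_neg u.2, diag, sub_mul]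
    have : (∑ d : G.Dart, if G.org d = u then truncDart H.weight γ.verts d * f (G.term d) else 0) =
        ∑ d : (G.delete γ).Dart, if (G.delete γ).org d = u then
          (H.delete γ).weight d * f ((G.delete γ).term d) else 0 := by
      symm
      refine Finset.sum_of_injOn ι hι.injOn (fun _ _ => Finset.mem_coe.2 (Finset.mem_univ _)) ?_ ?_
      · intro d _ hd
        split_ifs with h
        · rw [truncDart, if_neg, zero_mul]
          rintro ⟨h1, h2⟩
          obtain ⟨d', rfl⟩ := hιrange d h1 h2
          exact hd ⟨d', by simp, rfl⟩
        · rfl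
      · intro d _
        have htr : truncDart H.weight γ.verts (ι d) = H.weight (ι d) := if_pos (by
          rw [hιorg, hιterm]
          exact ⟨((G.delete γ).org d).2, ((G.delete γ).term d).2⟩)
        rw [htr, hιorg, hιterm, Subtype.coe_inj]
        congr!
    rw [this]
    have hpot : (H.delete γ).potential u = H.potential u := rfl
    rw [hpot]
    ring
  rw [← Matrix.exists_mulVec_eq_zero_iff]
  constructor
  · rintro ⟨g, _, hg0, hg⟩
    refine ⟨fun v => if h : v ∉ γ.verts then g ⟨v, h⟩ else 0, ?_, ?_⟩
    · intro h0
      refine hg0 (funext fun v => ?_)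
      have := congrFun h0 v
      simpa [v.2] using this
    · funext u
      by_cases hu : u ∈ γ.verts
      · rw [hout _ u hu]
        simp [hu]
      · have h1 : (fun v : {v // v ∉ γ.verts} =>
            (fun v => if h : v ∉ γ.verts then g ⟨v, h⟩ else 0) v.1) = g := by
          funext v
          simp [v.2]
        refine (hin _ ⟨u, hu⟩).trans ?_
        rw [h1, hg]
        simp [hu]
  · rintro ⟨f, hf0, hf⟩
    refine ⟨fun v => f v, Memℓp.all _, ?_, ?_⟩
    · intro h0
      refine hf0 (funext fun u => ?_)
      by_cases hu : u ∈ γ.verts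
      · rw [← hout f u hu, hf]
      · exact congrFun h0 ⟨u, hu⟩
    · funext u
      have := hin f u
      rw [hf] at this
      exact (sub_eq_zero.1 this.symm).symm

theorem forall_isRoot_iff (H : SchrodingerOperator G) (lam : ℝ) :
    (∀ γ : G.Subgraph, γ.IsDegree 2 → (H.matchingPolynomialDelete γ).IsRoot (lam : ℂ)) ↔
      ∀ O : Finset G.Dart, G.Oriented O →
        matchingSum H.weight (H.diag lam) (O.image G.org) = 0 := by
  rw [← forall_isDegree_two_iff fun W => matchingSum H.weight (H.diag lam) W = 0]
  simp only [Polynomial.IsRoot, eval_matchingPolynomialDelete]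
  rfl

theorem forall_isRoot_iff_forall_hasL2Eigenvalue (H : SchrodingerOperator G) (lam : ℝ) :
    (∀ γ : G.Subgraph, γ.IsDegree 2 → (H.matchingPolynomialDelete γ).IsRoot (lam : ℂ)) ↔
      ∀ γ : G.Subgraph, γ.IsDegree 2 → (H.delete γ).HasL2Eigenvalue lam := by
  rw [forall_isRoot_iff, forall_matchingSum_eq_zero_iff_forall_det,
    ← forall_isDegree_two_iff fun W => (G.dartMatrix (truncDart H.weight W)
      (truncVert (H.diag lam) W)).det = 0]
  simp only [hasL2Eigenvalue_delete_iff]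

end SchrodingerOperator

/-! ### The Schrödinger operator on `V × ℤ^E` -/

namespace MultiGraph

open scoped Classical

variable {V E : Type*} (G : MultiGraph V E)

/-- The class of a directed edge in `ℤ^E`. -/
noncomputable def shift (d : G.Dart) : E → ℤ := Pi.single d.1 (cond d.2 1 (-1))

theorem shift_rev (d : G.Dart) : G.shift (G.rev d) = -G.shift d := by
  obtain ⟨e, _ | _⟩ := d <;> simp [shift, rev, ← Pi.single_neg]

variable {G}

/-- At most one direction of each edge lies in `O`, so the coordinate of the edge is `1`, `-1` or
`0` and tells which. Hence `O` is determined by its total shift. -/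
theorem Oriented.sum_shift_apply {O : Finset G.Dart} (hO : G.Oriented O) (d : G.Dart) :
    (0 < cond d.2 (1 : ℤ) (-1) * (∑ x ∈ O, G.shift x) d.1) ↔ d ∈ O := by
  have h : ∀ e : E, (∑ x ∈ O, G.shift x) e =
      (if (e, true) ∈ O then 1 else 0) - (if (e, false) ∈ O then 1 else 0) := by
    intro e
    have h1 : ∀ x : G.Dart, G.shift x e =
        (if x = (e, true) then 1 else 0) - (if x = (e, false) then 1 else 0) := by
      rintro ⟨e', _ | _⟩ <;> rcases eq_or_ne e e' with rfl | he
      · simp [shift]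
      · simp [shift, he, he.symm]
      · simp [shift]
      · simp [shift, he, he.symm]
    simp [Finset.sum_apply, h1, Finset.sum_sub_distrib]
  have h1 := hO.rev_notMem d
  obtain ⟨e, _ | _⟩ := d <;> simp only [rev, Bool.not_true, Bool.not_false] at h1 <;>
    simp only [h, cond_true, cond_false] <;>
    by_cases ht : (e, true) ∈ O <;> by_cases hf : (e, false) ∈ O <;> simp_all

theorem Oriented.eq_of_sum_shift_eq {O O' : Finset G.Dart} (hO : G.Oriented O)
    (hO' : G.Oriented O') (h : ∑ x ∈ O, G.shift x = ∑ x ∈ O', G.shift x) : O = O' := by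
  ext d
  rw [← hO.sum_shift_apply, ← hO'.sum_shift_apply, h]

theorem prod_single {ι L : Type*} [AddCommMonoid L] (s : Finset ι) (m : ι → L) (w : ι → ℂ) :
    ∏ i ∈ s, AddMonoidAlgebra.single (m i) (w i) =
      AddMonoidAlgebra.single (∑ i ∈ s, m i) (∏ i ∈ s, w i) := by
  induction s using Finset.cons_induction with
  | empty => simp [AddMonoidAlgebra.one_def]
  | cons i s hi ih => simp

theorem sum_shift_bothDarts (M : Finset E) : ∑ d ∈ G.bothDarts M, G.shift d = 0 := by
  rw [Finset.sum_product]
  refine Finset.sum_eq_zero fun e _ => ?_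
  simp [shift, ← Pi.single_add]

section Twisted

variable [Fintype V] [Fintype E]

/-- The two directions of a matching edge have opposite shifts, so matchings contribute only to the
exponent zero. -/
theorem matchingSum_single (a : G.Dart → ℂ) (c : V → ℂ) (W : Finset V) :
    matchingSum (fun d => AddMonoidAlgebra.single (G.shift d) (a d))
      (fun u => AddMonoidAlgebra.single (0 : E → ℤ) (c u)) W =
      AddMonoidAlgebra.single 0 (matchingSum a c W) := by
  rw [matchingSum, matchingSum, ← AddMonoidAlgebra.singleAddHom_apply, map_sum]
  refine Finset.sum_congr rfl fun M _ => ?_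
  rw [prod_single, prod_single, sum_shift_bothDarts, Finset.sum_const_zero,
    AddMonoidAlgebra.singleAddHom_apply, mul_assoc, AddMonoidAlgebra.single_mul_single, add_zero,
    mul_assoc]
  have h : ((-1) ^ M.card : AddMonoidAlgebra ℂ (E → ℤ)) =
      AddMonoidAlgebra.single 0 ((-1) ^ M.card) := by
    change _ = AddMonoidAlgebra.singleZeroRingHom _
    rw [map_pow, map_neg, map_one]
  rw [h, AddMonoidAlgebra.single_mul_single, add_zero]

/-- The matrix of `c - a` on `V × ℤ^E`, with entries in the group ring of `ℤ^E`. -/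
noncomputable def twistedMatrix (a : G.Dart → ℂ) (c : V → ℂ) :
    Matrix V V (AddMonoidAlgebra ℂ (E → ℤ)) :=
  G.dartMatrix (fun d => AddMonoidAlgebra.single (G.shift d) (a d))
    (fun u => AddMonoidAlgebra.single 0 (c u))

theorem det_twistedMatrix (a : G.Dart → ℂ) (c : V → ℂ) : (twistedMatrix a c).det =
    ∑ O : Finset G.Dart with G.Oriented O, AddMonoidAlgebra.single (∑ d ∈ O, G.shift d)
      ((selfMapSign (G.move O) : ℂ) * (∏ d ∈ O, -a d) * matchingSum a c (O.image G.org)) := by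
  rw [twistedMatrix, det_dartMatrix]
  refine Finset.sum_congr rfl fun O _ => ?_
  have h : (selfMapSign (G.move O) : AddMonoidAlgebra ℂ (E → ℤ)) =
      AddMonoidAlgebra.single 0 (selfMapSign (G.move O) : ℂ) := by
    change _ = AddMonoidAlgebra.singleZeroRingHom _
    simp
  have h' : ∀ d, -AddMonoidAlgebra.single (G.shift d) (a d) =
      AddMonoidAlgebra.single (G.shift d) (-a d) := fun d => by
    simp [AddMonoidAlgebra.single_neg]
  simp only [h']
  rw [matchingSum_single, prod_single, h, AddMonoidAlgebra.single_mul_single,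
    AddMonoidAlgebra.single_mul_single, zero_add, add_zero]

/-- Distinct `O` give distinct exponents, so each coefficient consists of a single term: a sign and
non-zero weights times one matching sum. -/
theorem det_twistedMatrix_eq_zero_iff {a : G.Dart → ℂ} (ha : ∀ d, a d ≠ 0) (c : V → ℂ) :
    (twistedMatrix a c).det = 0 ↔
      ∀ O : Finset G.Dart, G.Oriented O → matchingSum a c (O.image G.org) = 0 := by
  rw [det_twistedMatrix]
  constructor
  · intro h O hO
    have h1 := congrArg (fun p => p.coeff (∑ d ∈ O, G.shift d)) h
    simp only [AddMonoidAlgebra.coeff_sum, AddMonoidAlgebra.coeff_single,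
      AddMonoidAlgebra.coeff_zero, Finsupp.finsetSum_apply, Finsupp.zero_apply] at h1
    rw [Finset.sum_eq_single O] at h1
    · rw [Finsupp.single_eq_same] at h1
      refine (mul_eq_zero.1 h1).resolve_left (mul_ne_zero ?_ ?_)
      · exact Int.cast_ne_zero.2 (selfMapSign_ne_zero hO.injective_move)
      · exact Finset.prod_ne_zero_iff.2 fun d _ => neg_ne_zero.2 (ha d)
    · intro O' hO' hne
      rw [Finsupp.single_apply, if_neg]
      exact fun h => hne ((Finset.mem_filter.1 hO').2.eq_of_sum_shift_eq hO h)
    · intro hn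
      exact absurd (Finset.mem_filter.2 ⟨Finset.mem_univ _, hO⟩) hn
  · intro h
    refine Finset.sum_eq_zero fun O hO => ?_
    rw [h O (Finset.mem_filter.1 hO).2, mul_zero, AddMonoidAlgebra.single_zero]

end Twisted

/-- The action of `ℤ^E` on functions by translation. -/
noncomputable def translation (E : Type*) :
    Multiplicative (E → ℤ) →* Module.End ℂ ((E → ℤ) → ℂ) where
  toFun m := LinearMap.funLeft ℂ ℂ fun n => n + m.toAdd
  map_one' := by
    ext
    simp [LinearMap.funLeft]
  map_mul' m m' := by
    refine LinearMap.ext fun g => funext fun n => ?_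
    simp [LinearMap.funLeft, add_assoc]

/-- The action of the group ring of `ℤ^E` on functions. -/
noncomputable def groupRingAction (E : Type*) :
    AddMonoidAlgebra ℂ (E → ℤ) →ₐ[ℂ] Module.End ℂ ((E → ℤ) → ℂ) :=
  AddMonoidAlgebra.lift ℂ _ _ (translation E)

theorem groupRingAction_single (m : E → ℤ) (c : ℂ) (g : (E → ℤ) → ℂ) (n : E → ℤ) :
    groupRingAction E (AddMonoidAlgebra.single m c) g n = c * g (n + m) := by
  simp [groupRingAction, AddMonoidAlgebra.lift_single, translation, LinearMap.funLeft]

theorem groupRingAction_apply (p : AddMonoidAlgebra ℂ (E → ℤ)) (g : (E → ℤ) → ℂ) (n : E → ℤ) :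
    groupRingAction E p g n = ∑ k ∈ p.coeff.support, p.coeff k * g (n + k) := by
  rw [groupRingAction, AddMonoidAlgebra.lift_apply, Finsupp.sum, LinearMap.sum_apply,
    Finset.sum_apply]
  simp [translation, LinearMap.funLeft]

/-- Cramer's rule: applying the adjugate to the system `M f = 0` leaves `det M` acting on each
component. -/
theorem action_det_eq_zero [Fintype V] {A S W : Type*} [CommRing A] [CommRing S] [AddCommGroup W]
    [Module S W] (T : A →+* Module.End S W) (M : Matrix V V A) (f : V → W)
    (h : ∀ u, ∑ v, T (M u v) (f v) = 0) (v : V) : T M.det (f v) = 0 := by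
  have h1 : ∑ u, T (M.adjugate v u) (∑ w, T (M u w) (f w)) = 0 :=
    Finset.sum_eq_zero fun u _ => by rw [h, map_zero]
  simp only [map_sum] at h1
  rw [Finset.sum_comm] at h1
  have h2 : ∀ w, ∑ u, T (M.adjugate v u) (T (M u w) (f w)) = T ((M.adjugate * M) v w) (f w) := by
    intro w
    rw [Matrix.mul_apply, map_sum, LinearMap.sum_apply]
    simp
  simp only [h2, Matrix.adjugate_mul] at h1
  rw [Finset.sum_eq_single v] at h1
  · simpa using h1
  · intro w _ hw
    simp [hw.symm]
  · simp

end MultiGraph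

/-! ### Lattice eigenfunctions and the determinant over the group ring -/

namespace SchrodingerOperator

open scoped Classical

open MultiGraph

variable {V E : Type*} {G : MultiGraph V E} [Fintype E]

/-- The lift of a Schrödinger operator to the (in general disconnected) cover `V × ℤ^E`. -/
noncomputable def latticeOp (H : SchrodingerOperator G) (F : V × (E → ℤ) → ℂ)
    (p : V × (E → ℤ)) : ℂ :=
  (∑ d : G.Dart, if G.org d = p.1 then H.weight d * F (G.term d, p.2 + G.shift d) else 0) +
    H.potential p.1 * F p

theorem exists_lattice_eigenfunction_iff [Fintype V] (H : SchrodingerOperator G) (lam : ℝ) :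
    (∃ F : V × (E → ℤ) → ℂ, Memℓp F 2 ∧ F ≠ 0 ∧ ∀ p, H.latticeOp F p = lam * F p) ↔
      (twistedMatrix H.weight (H.diag lam)).det = 0 := by
  constructor
  · rintro ⟨F, hF, hF0, hop⟩
    by_contra hdet
    obtain ⟨m, hm⟩ : ∃ m, (twistedMatrix H.weight (H.diag lam)).det.coeff m ≠ 0 := by
      by_contra! h
      exact hdet (AddMonoidAlgebra.ext (Finsupp.ext h))
    refine hF0 (funext fun ⟨v, n⟩ => ?_)
    refine congrFun (eq_zero_of_sum_shift_eq_zero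
      (twistedMatrix H.weight (H.diag lam)).det.coeff.support _ (Finsupp.mem_support_iff.2 hm) hm
      (fun n => F (v, n)) ?_ fun n => ?_) n
    · refine memℓp_gen ?_
      exact (hF.summable (by simp)).comp_injective (Prod.mk_right_injective v)
    · rw [← groupRingAction_apply _ fun n => F (v, n)]
      refine congrFun (action_det_eq_zero (groupRingAction E).toRingHom
        (twistedMatrix H.weight (H.diag lam)) (fun v n => F (v, n)) (fun u => ?_) v) n
      funext n
      have h1 := hop (u, n)
      simp only [twistedMatrix, dartMatrix, AlgHom.toRingHom_eq_coe, RingHom.coe_coe, map_sub,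
        LinearMap.sub_apply, Finset.sum_sub_distrib, Pi.sub_apply, Finset.sum_apply, map_sum,
        LinearMap.sum_apply, Pi.zero_apply]
      rw [Finset.sum_eq_single u, Finset.sum_comm, Finset.sum_congr rfl (g := fun d : G.Dart =>
        if G.org d = u then H.weight d * F (G.term d, n + G.shift d) else 0)]
      · rw [if_pos rfl, groupRingAction_single, add_zero, diag, sub_mul, ← h1, latticeOp]
        ring
      · intro d _
        by_cases h : G.org d = u
        · rw [Finset.sum_eq_single (G.term d)]
          · simp [h, groupRingAction_single]
          · intro w _ hw
            simp [hw.symm]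
          · simp
        · simp [h]
      · intro w _ hw
        simp [hw.symm]
      · simp
  · intro hdet
    obtain ⟨q, hq0, hq⟩ := Matrix.exists_mulVec_eq_zero_iff.2 hdet
    -- Multiplication by the monomial `m` moves coefficients from `n - m` to `n`, while the operator
    -- evaluates at `n + m`; the sign reconciles the two.
    refine ⟨fun p => (q p.1).coeff (-p.2), ?_, ?_, ?_⟩
    · refine (memℓp_zero ?_).of_exponent_ge zero_le
      have : Set.Finite (⋃ v : V, (fun n => (v, -n)) '' ((q v).coeff.support : Set (E → ℤ))) :=
        Set.finite_iUnion fun v => (Finset.finite_toSet _).image _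
      refine this.subset ?_
      rintro ⟨v, n⟩ h
      exact Set.mem_iUnion.2 ⟨v, -n, by simpa using h, by simp⟩
    · intro h0
      refine hq0 (funext fun v => AddMonoidAlgebra.ext (Finsupp.ext fun n => ?_))
      simpa using congrFun h0 (v, -n)
    · rintro ⟨u, n⟩
      have h1 := congrArg (fun p => p.coeff (-n)) (congrFun hq u)
      simp only [twistedMatrix, dartMatrix_mulVec, Pi.zero_apply, AddMonoidAlgebra.coeff_zero,
        Finsupp.zero_apply, AddMonoidAlgebra.coeff_sub, Finsupp.sub_apply,
        AddMonoidAlgebra.coeff_sum, Finsupp.finsetSum_apply,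
        AddMonoidAlgebra.coeff_single_mul_apply, neg_zero, zero_add] at h1
      have h2 : ∀ d : G.Dart, (if G.org d = u then AddMonoidAlgebra.single (G.shift d)
          (H.weight d) * q (G.term d) else 0).coeff (-n) =
          if G.org d = u then H.weight d * (q (G.term d)).coeff (-(n + G.shift d)) else 0 := by
        intro d
        split_ifs
        · rw [AddMonoidAlgebra.coeff_single_mul_apply, neg_add_rev]
        · rfl
      simp only [h2, diag] at h1
      simp only [latticeOp]
      linear_combination -h1

end SchrodingerOperator

/-! ### The maximal abelian cover as a component of `V × ℤ^E` -/

namespace MultiGraph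

open scoped Classical

variable {V E : Type*} {G : MultiGraph V E}

section Label

variable {A B : Type*} [CommGroup A] [CommGroup B]

/-- The functor on the fundamental groupoid that multiplies the labels of the edges of a walk. -/
def labelFunctor (G : MultiGraph V E) (l : E → A) : G.FundGroupoid ⥤ SingleObj A :=
  Quiver.FreeGroupoid.lift
    { obj := fun _ => SingleObj.star A
      map := fun f => (f.1 : E) |> l }

/-- The product of the labels of the edges of a walk. -/
def label (l : E → A) {x y : G.FundGroupoid} (p : x ⟶ y) : A := (labelFunctor G l).map p

theorem label_comp (l : E → A) {x y z : G.FundGroupoid} (p : x ⟶ y) (q : y ⟶ z) :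
    label l (p ≫ q) = label l p * label l q := by
  -- Composition in `SingleObj A` multiplies in the opposite order.
  rw [mul_comm]
  exact (labelFunctor G l).map_comp p q

theorem label_id (l : E → A) (x : G.FundGroupoid) : label l (𝟙 x) = 1 :=
  (labelFunctor G l).map_id x

theorem label_inv (l : E → A) {x y : G.FundGroupoid} (p : x ⟶ y) :
    label l (Groupoid.inv p) = (label l p)⁻¹ := by
  rw [eq_inv_iff_mul_eq_one, ← label_comp, Groupoid.inv_comp, label_id]

theorem map_eq_label (Ψ : G.FundGroupoid ⥤ SingleObj A) {x y : G.FundGroupoid} (p : x ⟶ y) :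
    (show A from Ψ.map p) = label (fun e => (show A from Ψ.map (G.step e))) p := by
  have h : Ψ = labelFunctor G (fun e => (show A from Ψ.map (G.step e))) := by
    refine Quiver.FreeGroupoid.lift_unique _ _ ?_
    refine Prefunctor.ext (fun _ => rfl) ?_
    rintro u v ⟨e, rfl, rfl⟩
    rfl
  -- In `h` the functor `Ψ` also occurs on the right, inside the labels; a general `l` makes the
  -- substitution possible.
  have key : ∀ l : E → A, Ψ = labelFunctor G l → (show A from Ψ.map p) = label l p := by
    rintro l rfl
    rfl
  exact key _ h

theorem label_step (l : E → A) (e : E) : label l (G.step e) = l e :=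
  mul_one (l e)

theorem map_label (φ : A →* B) (l : E → A) {x y : G.FundGroupoid} (p : x ⟶ y) :
    φ (label l p) = label (fun e => φ (l e)) p := by
  let Ψ : G.FundGroupoid ⥤ SingleObj B :=
    { obj := fun _ => SingleObj.star B
      map := fun q => φ (label l q)
      map_id := fun x => by rw [label_id, map_one]; rfl
      map_comp := fun q r => by rw [label_comp, mul_comm, map_mul]; rfl }
  have h := map_eq_label Ψ p
  have h' : ∀ e, (show B from Ψ.map (G.step e)) = φ (l e) := fun e => congrArg φ (label_step l e)
  simp only [h'] at h
  exact h

end Label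

/-- The signed numbers of traversals of the edges by a walk. -/
noncomputable def edgeCount {x y : G.FundGroupoid} (p : x ⟶ y) : E → ℤ :=
  (label (fun e => Multiplicative.ofAdd (Pi.single e (1 : ℤ) : E → ℤ)) p).toAdd

theorem edgeCount_comp {x y z : G.FundGroupoid} (p : x ⟶ y) (q : y ⟶ z) :
    edgeCount (p ≫ q) = edgeCount p + edgeCount q := by
  rw [edgeCount, label_comp]
  rfl

theorem edgeCount_inv {x y : G.FundGroupoid} (p : x ⟶ y) :
    edgeCount (Groupoid.inv p) = -edgeCount p := by
  rw [edgeCount, label_inv]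
  rfl

theorem edgeCount_step (e : E) : edgeCount (G.step e) = Pi.single e 1 := by
  rw [edgeCount, label_step]
  rfl

theorem edgeCount_eq_zero_of_mem_commutator {b : V} {γ : G.FundGroup b}
    (h : γ ∈ commutator (G.FundGroup b)) : edgeCount (End.asHom γ) = 0 := by
  let φ : G.FundGroup b →* Multiplicative (E → ℤ) :=
    { toFun := fun γ => Multiplicative.ofAdd (edgeCount (End.asHom γ))
      map_one' := by
        change Multiplicative.ofAdd (edgeCount (𝟙 (G.pt b))) = 1
        rw [edgeCount, label_id]
        rfl
      map_mul' := fun γ δ => by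
        change Multiplicative.ofAdd (edgeCount (End.asHom δ ≫ End.asHom γ)) = _
        rw [edgeCount_comp, add_comm]
        rfl }
  exact congrArg Multiplicative.toAdd (Abelianization.commutator_subset_ker φ h)

theorem Connected.nonempty_walk (hG : G.Connected) (u v : V) : Nonempty (G.pt u ⟶ G.pt v) := by
  have h := hG.2 u v
  induction h with
  | refl => exact ⟨𝟙 _⟩
  | tail _ h ih =>
    obtain ⟨p⟩ := ih
    obtain ⟨⟨e, _ | _⟩, rfl, rfl⟩ := h
    · exact ⟨p ≫ Groupoid.inv (G.step e)⟩
    · exact ⟨p ≫ G.step e⟩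

theorem _root_.CategoryTheory.End.comp_comp_inv {C : Type*} [Groupoid C] {x : C} (p q : End x) :
    End.of (End.asHom p ≫ End.asHom q ≫ Groupoid.inv (End.asHom p)) = p⁻¹ * q * p :=
  rfl

/-- A closed walk in a connected graph that traverses each edge equally often in both directions is
a product of commutators. -/
theorem Connected.mem_commutator [Fintype E] (hG : G.Connected) {b : V} {γ : G.FundGroup b}
    (h : edgeCount (End.asHom γ) = 0) : γ ∈ commutator (G.FundGroup b) := by
  have hw : ∀ x : G.FundGroupoid, Nonempty (G.pt b ⟶ x) := fun x => hG.nonempty_walk b x.as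
  obtain ⟨w⟩ : Nonempty (∀ x : G.FundGroupoid, G.pt b ⟶ x) := ⟨fun x => (hw x).some⟩
  -- Reference walks from `b` close up every walk to a loop at `b`. The class of this loop in the
  -- abelianization is functorial, hence determined by its values on edges, and so it factors
  -- through the edge counts.
  let cl : ∀ {x y : G.FundGroupoid}, (x ⟶ y) → G.FundGroup b := fun {x y} p =>
    End.of (w x ≫ p ≫ Groupoid.inv (w y))
  let Ψ : G.FundGroupoid ⥤ SingleObj (Abelianization (G.FundGroup b)) :=
    { obj := fun _ => SingleObj.star _
      map := fun p => Abelianization.of (cl p)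
      map_id := fun x => by
        have : cl (𝟙 x) = 1 := by
          change w x ≫ 𝟙 x ≫ Groupoid.inv (w x) = 𝟙 _
          simp
        rw [this, map_one]
        rfl
      map_comp := fun {x y z} p q => by
        have : cl (p ≫ q) = cl q * cl p := by
          change w x ≫ (p ≫ q) ≫ Groupoid.inv (w z) =
            (w x ≫ p ≫ Groupoid.inv (w y)) ≫ (w y ≫ q ≫ Groupoid.inv (w z))
          simp
        rw [this, map_mul]
        rfl }
  let l : E → Abelianization (G.FundGroup b) := fun e => Ψ.map (G.step e)
  let φ : Multiplicative (E → ℤ) →* Abelianization (G.FundGroup b) :=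
    { toFun := fun n => ∏ e, l e ^ n.toAdd e
      map_one' := by simp
      map_mul' := fun m n => by
        simp [zpow_add, Finset.prod_mul_distrib] }
  have hφ : ∀ e, φ (Multiplicative.ofAdd (Pi.single e (1 : ℤ) : E → ℤ)) = l e := by
    intro e
    change ∏ e', l e' ^ (Pi.single e (1 : ℤ) : E → ℤ) e' = l e
    rw [Finset.prod_eq_single e]
    · simp
    · intro e' _ he
      simp [he]
    · simp
  clear_value φ
  have h0 : label (fun e => Multiplicative.ofAdd (Pi.single e (1 : ℤ) : E → ℤ)) (End.asHom γ) = 1 :=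
    congrArg Multiplicative.ofAdd h
  have h1 := map_label φ (fun e => Multiplicative.ofAdd (Pi.single e (1 : ℤ) : E → ℤ))
    (End.asHom γ)
  rw [h0, map_one] at h1
  simp only [hφ] at h1
  replace h1 : 1 = Abelianization.of (cl (End.asHom γ)) :=
    h1.trans (map_eq_label Ψ (End.asHom γ)).symm
  -- The reference walk from `b` to itself need not be trivial; it only conjugates `γ`, which the
  -- abelianization does not see.
  have h2 : cl (End.asHom γ) = (End.of (w (G.pt b)))⁻¹ * γ * End.of (w (G.pt b)) :=
    End.comp_comp_inv (End.of (w (G.pt b))) γ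
  rw [h2, map_mul, map_mul, map_inv, mul_comm, mul_inv_cancel_left] at h1
  rw [← Abelianization.ker_of]
  exact h1.symm

end MultiGraph

/-! ### Lattice coordinates on the maximal abelian cover -/

namespace MultiGraph

open scoped Classical

variable {V E : Type*} {G : MultiGraph V E} {b : V}

theorem edgeCount_smul_walk {γ : G.FundGroup b} (h : γ ∈ commutator (G.FundGroup b)) {v : V}
    (p : G.pt b ⟶ G.pt v) : edgeCount (Groupoid.inv (End.asHom γ) ≫ p) = edgeCount p := by
  rw [edgeCount_comp, edgeCount_inv, edgeCount_eq_zero_of_mem_commutator h, neg_zero, zero_add]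

/-- The closed walk `q` followed by the inverse of `p` has edge count zero, so it lies in the
commutator subgroup. This makes the lattice coordinates injective. -/
theorem Connected.exists_commutator [Fintype E] (hG : G.Connected) {v : V}
    {p q : G.pt b ⟶ G.pt v} (h : edgeCount p = edgeCount q) :
    ∃ γ : commutator (G.FundGroup b), Groupoid.inv (End.asHom γ.1) ≫ q = p := by
  refine ⟨⟨End.of (q ≫ Groupoid.inv p), hG.mem_commutator ?_⟩, ?_⟩
  · change edgeCount (q ≫ Groupoid.inv p) = 0
    rw [edgeCount_comp, edgeCount_inv, h, add_neg_cancel]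
  · change Groupoid.inv (q ≫ Groupoid.inv p) ≫ q = p
    simp

/-- The position of a vertex of the maximal abelian cover in `V × ℤ^E`. -/
noncomputable def abPos (G : MultiGraph V E) (b : V) : G.AbVertex b → V × (E → ℤ) :=
  Quotient.lift (fun x : G.UnivVertex b => (x.vert, edgeCount x.walk)) (by
    rintro _ y ⟨γ, rfl⟩
    exact Prod.ext rfl (edgeCount_smul_walk γ.2 y.walk))

/-- The position of the source of an edge of the maximal abelian cover, together with the edge below
it. -/
noncomputable def abPosEdge (G : MultiGraph V E) (b : V) : G.AbEdge b → E × (E → ℤ) :=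
  Quotient.lift (fun x : G.UnivEdge b => (x.edge, edgeCount x.walk)) (by
    rintro _ y ⟨γ, rfl⟩
    exact Prod.ext rfl (edgeCount_smul_walk γ.2 y.walk))

theorem Connected.abPos_injective [Fintype E] (hG : G.Connected) (b : V) :
    Function.Injective (G.abPos b) := by
  intro q q' h
  induction q using Quotient.inductionOn' with
  | _ x =>
  induction q' using Quotient.inductionOn' with
  | _ y =>
  obtain ⟨u, p⟩ := x
  obtain ⟨v, p'⟩ := y
  obtain ⟨h1, h2⟩ := Prod.ext_iff.1 h
  change u = v at h1
  subst h1
  obtain ⟨γ, hγ⟩ := hG.exists_commutator (p := p) (q := p') h2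
  exact Quotient.sound' ⟨γ, UnivVertex.ext rfl (heq_of_eq hγ)⟩

theorem Connected.abPosEdge_injective [Fintype E] (hG : G.Connected) (b : V) :
    Function.Injective (G.abPosEdge b) := by
  intro q q' h
  induction q using Quotient.inductionOn' with
  | _ x =>
  induction q' using Quotient.inductionOn' with
  | _ y =>
  obtain ⟨e, p⟩ := x
  obtain ⟨e', p'⟩ := y
  obtain ⟨h1, h2⟩ := Prod.ext_iff.1 h
  change e = e' at h1
  subst h1
  obtain ⟨γ, hγ⟩ := hG.exists_commutator (p := p) (q := p') h2
  exact Quotient.sound' ⟨γ, UnivEdge.ext rfl (heq_of_eq hγ)⟩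

theorem abPos_fst (q : G.AbVertex b) : (G.abPos b q).1 = G.abProjV b q := by
  induction q using Quotient.inductionOn' with
  | _ x => rfl

theorem abPosEdge_fst (q : G.AbEdge b) : (G.abPosEdge b q).1 = G.abProjE b q := by
  induction q using Quotient.inductionOn' with
  | _ x => rfl

/-- The directed edge below a directed edge of the maximal abelian cover. -/
def abProjDart (G : MultiGraph V E) (b : V) (d : (G.abCover b).Dart) : G.Dart :=
  (G.abProjE b d.1, d.2)

theorem abPos_src (q : G.AbEdge b) :
    G.abPos b ((G.abCover b).src q) = (G.src (G.abProjE b q), (G.abPosEdge b q).2) := by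
  induction q using Quotient.inductionOn' with
  | _ x => rfl

theorem abPos_tgt (q : G.AbEdge b) : G.abPos b ((G.abCover b).tgt q) =
    (G.tgt (G.abProjE b q), (G.abPosEdge b q).2 + Pi.single (G.abProjE b q) 1) := by
  induction q using Quotient.inductionOn' with
  | _ x =>
    obtain ⟨e, p⟩ := x
    refine Prod.ext rfl ?_
    change edgeCount (p ≫ G.step e) = edgeCount p + _
    rw [edgeCount_comp, edgeCount_step]
    rfl

theorem org_abProjDart (d : (G.abCover b).Dart) :
    G.org (G.abProjDart b d) = (G.abPos b ((G.abCover b).org d)).1 := by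
  obtain ⟨q, _ | _⟩ := d
  · exact (congrArg Prod.fst (abPos_tgt q)).symm
  · exact (congrArg Prod.fst (abPos_src q)).symm

theorem abPos_term (d : (G.abCover b).Dart) : G.abPos b ((G.abCover b).term d) =
    (G.term (G.abProjDart b d),
      (G.abPos b ((G.abCover b).org d)).2 + G.shift (G.abProjDart b d)) := by
  obtain ⟨q, _ | _⟩ := d
  · refine (abPos_src q).trans (Prod.ext rfl ?_)
    change _ = (G.abPos b ((G.abCover b).tgt q)).2 + Pi.single (G.abProjE b q) (-1)
    simp [abPos_tgt, add_assoc, ← Pi.single_add]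
  · refine (abPos_tgt q).trans (Prod.ext rfl ?_)
    change _ = (G.abPos b ((G.abCover b).src q)).2 + Pi.single (G.abProjE b q) 1
    rw [abPos_src]

/-- Uniqueness of lifts of a directed edge from a given vertex; `exists_dart_lift` gives their
existence. Together they make `abPos` an isomorphism on stars. -/
theorem Connected.dart_eq [Fintype E] (hG : G.Connected) {d d' : (G.abCover b).Dart}
    (horg : (G.abCover b).org d = (G.abCover b).org d')
    (hproj : G.abProjDart b d = G.abProjDart b d') : d = d' := by
  obtain ⟨q, s⟩ := d
  obtain ⟨q', s'⟩ := d'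
  obtain ⟨h1, rfl⟩ : G.abProjE b q = G.abProjE b q' ∧ s = s' := Prod.ext_iff.1 hproj
  refine Prod.ext (hG.abPosEdge_injective b (Prod.ext ?_ ?_)) rfl
  · rw [abPosEdge_fst, abPosEdge_fst]
    exact h1
  · have h2 := congrArg (fun x => (G.abPos b x).2) horg
    cases s
    · change (G.abPos b ((G.abCover b).tgt q)).2 = (G.abPos b ((G.abCover b).tgt q')).2 at h2
      rw [abPos_tgt, abPos_tgt, h1] at h2
      exact add_right_cancel h2
    · change (G.abPos b ((G.abCover b).src q)).2 = (G.abPos b ((G.abCover b).src q')).2 at h2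
      rwa [abPos_src, abPos_src] at h2

theorem exists_dart_lift (q : G.AbVertex b) {d : G.Dart} (hd : G.org d = (G.abPos b q).1) :
    ∃ d' : (G.abCover b).Dart, (G.abCover b).org d' = q ∧ G.abProjDart b d' = d := by
  induction q using Quotient.inductionOn' with
  | _ x =>
  obtain ⟨v, p⟩ := x
  change G.org d = v at hd
  subst hd
  obtain ⟨e, _ | _⟩ := d
  · refine ⟨(Quotient.mk'' ⟨e, p ≫ Groupoid.inv (G.step e)⟩, false), ?_, rfl⟩
    refine congrArg (Quotient.mk'' (s₁ := MulAction.orbitRel _ _))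
      (UnivVertex.ext rfl (heq_of_eq ?_))
    have h : Groupoid.inv (G.step e) ≫ G.step e = 𝟙 _ := Groupoid.inv_comp _
    exact (Category.assoc _ _ _).trans ((congrArg (p ≫ ·) h).trans (Category.comp_id p))
  · exact ⟨(Quotient.mk'' ⟨e, p⟩, true), rfl, rfl⟩

theorem Connected.exists_abPos_fst_eq (hG : G.Connected) (b v : V) :
    ∃ q : G.AbVertex b, (G.abPos b q).1 = v := by
  obtain ⟨p⟩ := hG.nonempty_walk b v
  exact ⟨Quotient.mk'' ⟨v, p⟩, rfl⟩

end MultiGraph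

/-! ### Transfer of eigenfunctions between the cover and the lattice -/

namespace SchrodingerOperator

open scoped Classical

open MultiGraph

variable {V E : Type*} {G : MultiGraph V E} [Fintype E]

theorem ab_op_comp_abPos (hG : G.Connected) (b : V) (H : SchrodingerOperator G)
    (F : V × (E → ℤ) → ℂ) (q : G.AbVertex b) :
    (H.ab b).op (F ∘ G.abPos b) q = H.latticeOp F (G.abPos b q) := by
  have hmem : ∀ d, d ∈ (G.abCover b).dartsFrom q ↔ (G.abCover b).org d = q := fun d => by
    simp [dartsFrom]
  rw [latticeOp, ← Finset.sum_filter]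
  change (∑ d ∈ (G.abCover b).dartsFrom q, H.weight (G.abProjDart b d) *
    (F ∘ G.abPos b) ((G.abCover b).term d)) +
      (H.potential (G.abProjV b q) : ℂ) * F (G.abPos b q) = _
  refine congrArg₂ (· + ·) ?_ ?_
  · refine Finset.sum_nbij (G.abProjDart b) ?_ ?_ ?_ ?_
    · intro d hd
      rw [hmem] at hd
      simp [org_abProjDart, hd]
    · intro d hd d' hd' h
      rw [Finset.mem_coe, hmem] at hd hd'
      exact hG.dart_eq (hd.trans hd'.symm) h
    · intro d hd
      obtain ⟨d', h1, h2⟩ := exists_dart_lift q (by simpa using hd)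
      exact ⟨d', by simpa [hmem] using h1, h2⟩
    · intro d hd
      rw [hmem] at hd
      rw [Function.comp_apply, abPos_term, hd]
  · rw [abPos_fst]

theorem hasL2Eigenvalue_ab_iff (hG : G.Connected) (b : V) (H : SchrodingerOperator G) (lam : ℝ) :
    (H.ab b).HasL2Eigenvalue lam ↔
      ∃ F : V × (E → ℤ) → ℂ, Memℓp F 2 ∧ F ≠ 0 ∧ ∀ p, H.latticeOp F p = lam * F p := by
  have hinj := hG.abPos_injective b
  have h2 : 0 < (2 : ENNReal).toReal := by simp
  constructor
  · rintro ⟨f, hf, hf0, hop⟩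
    -- Extension by zero is an eigenfunction because the image of the cover is closed under
    -- adjacency.
    let F : V × (E → ℤ) → ℂ := Function.extend (G.abPos b) f fun _ => 0
    have hFf : F ∘ G.abPos b = f := Function.extend_comp hinj f _
    have hF0 : ∀ p ∉ Set.range (G.abPos b), F p = 0 := fun p hp =>
      Function.extend_apply' f _ p hp
    refine ⟨F, memℓp_gen ?_, ?_, fun p => ?_⟩
    · rw [← hinj.summable_iff (fun p hp => by rw [hF0 p hp]; simp)]
      have := hf.summable h2
      rw [← hFf] at this
      exact this
    · intro h0
      rw [← hFf, h0] at hf0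
      exact hf0 rfl
    · by_cases hp : p ∈ Set.range (G.abPos b)
      · obtain ⟨q, rfl⟩ := hp
        rw [← ab_op_comp_abPos hG, hFf, hop, ← hFf]
        rfl
      · rw [latticeOp, hF0 p hp, mul_zero, mul_zero, add_zero]
        refine Finset.sum_eq_zero fun d _ => ?_
        split_ifs with h
        · rw [hF0, mul_zero]
          rintro ⟨q, hq⟩
          -- If a neighbour of `p` were in the image, lifting the reversed directed edge there would
          -- put `p` in the image too.
          obtain ⟨d', h1, h2⟩ := exists_dart_lift q (d := G.rev d) (by rw [hq, G.org_rev])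
          refine hp ⟨(G.abCover b).term d', ?_⟩
          rw [abPos_term, h1, h2, hq, shift_rev, G.term_rev, h]
          simp
        · rfl
  · rintro ⟨F, hF, hF0, hop⟩
    obtain ⟨⟨v, n⟩, hvn⟩ := Function.ne_iff.1 hF0
    obtain ⟨q, hq⟩ := hG.exists_abPos_fst_eq b v
    -- The image meets the fibre over `v` at `q`; translating by `k`, which commutes with the
    -- operator, brings the non-zero value of `F` at `(v, n)` to that point.
    let k : E → ℤ := n - (G.abPos b q).2
    let F' : V × (E → ℤ) → ℂ := fun p => F (p.1, p.2 + k)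
    have htrans : Function.Injective fun p : V × (E → ℤ) => (p.1, p.2 + k) := by
      rintro ⟨u, m⟩ ⟨u', m'⟩ h
      simpa using h
    refine ⟨F' ∘ G.abPos b, memℓp_gen ?_, ?_, ?_⟩
    · exact (hF.summable h2).comp_injective (htrans.comp hinj)
    · intro h0
      refine hvn ?_
      have h1 := congrFun h0 q
      simpa [F', k, hq] using h1
    · funext x
      rw [ab_op_comp_abPos hG]
      have h1 := hop ((G.abPos b x).1, (G.abPos b x).2 + k)
      simp only [latticeOp, add_right_comm _ k] at h1
      exact h1

end SchrodingerOperator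

theorem theorem1p1 {V E : Type*} [Fintype V] [Fintype E] (G : MultiGraph V E)
    (hG : G.Connected) (b : V) (H : SchrodingerOperator G) (lam : ℝ) :
    ((H.ab b).HasL2Eigenvalue lam ↔
      ∀ γ : G.Subgraph, γ.IsDegree 2 → (H.matchingPolynomialDelete γ).IsRoot (lam : ℂ)) ∧
    ((H.ab b).HasL2Eigenvalue lam ↔
      ∀ γ : G.Subgraph, γ.IsDegree 2 → (H.delete γ).HasL2Eigenvalue lam) := by
  have h : (H.ab b).HasL2Eigenvalue lam ↔
      ∀ γ : G.Subgraph, γ.IsDegree 2 → (H.matchingPolynomialDelete γ).IsRoot (lam : ℂ) := by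
    rw [SchrodingerOperator.hasL2Eigenvalue_ab_iff hG,
      SchrodingerOperator.exists_lattice_eigenfunction_iff,
      MultiGraph.det_twistedMatrix_eq_zero_iff H.weight_ne_zero,
      SchrodingerOperator.forall_isRoot_iff]
  exact ⟨h, h.trans (H.forall_isRoot_iff_forall_hasL2Eigenvalue lam)⟩
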